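/- Let $N\ge 1$ be an integer and let $\mu\in\mathbb C$ satisfy $\mu\ne \frac N2+2k$ and $\mu\neq-(\frac N2+2k)$ for all $k=0,1,2,\dots$. For $\nu\in\mathbb C$ let $$V_\nu=\{f\in C^\infty(\mathbb R^N\setminus\{0\};\mathbb C): f(tX)=|t|^{-\nu-\frac N2}f(X)\ \text{for all } t\in\mathbb R\setminus\{0\},\ X\in\mathbb R^N\setminus\{0\}\}.$$ For $f\in V_\nu$ and $z\in\mathbb C$ put $f_z(r\omega)=r^{z}f(\omega)$ $(r>0,\ \omega\in S^{N-1})$, so that $f=f_{-\nu-N/2}$. Then for $\nu=\mu$ and for $\nu=-\mu$ the space $V_\nu$ is regarded as a linear subspace of the space $\mathcal S'(\mathbb R^N)$ of tempered distributions through the injective linear map $\iota_\nu:V_\nu\to\mathcal S'(\mathbb R^N)$ defined by meromorphic continuation: for every $\varphi\in\mathcal S(\mathbb R^N)$ the function $z\mapsto\int_{\mathbb R^N}f_z(x)\varphi(x)\,dx$, $\operatorname{Re}z>-N$, extends to a meromorphic function on $\mathbb C$ that is holomorphic at $z=-\nu-\frac N2$ (after removing a removable singularity, if there is one), and $\langle\iota_\nu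 f,\varphi\rangle$ is its value there. With these identifications, the Fourier transform $\mathcal F:\mathcal S'(\mathbb R^N)\to\mathcal S'(\mathbb R^N)$, normalized on functions by $(\mathcal Ff)(Y)=\int_{\mathbb R^N}f(X)e^{-2\pi i\langle X,Y\rangle}\,dX$, restricts to a bijection from $V_{-\mu}$ onto $V_\mu$. -/

import Mathlib

open scoped ContDiff FourierTransform SchwartzMap

noncomputable section

/-- The space `V_μ(ℝ^N)` of smooth complex-valued functions `f` on `ℝ^N ∖ {0}` such that
`f (t X) = |t| ^ (-μ - N/2) f X` for every real `t ≠ 0`. A function on `ℝ^N ∖ {0}` is represented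
by its extension to `ℝ^N` with the value `0` at the origin. -/
def homogeneousFunctions (N : ℕ) (μ : ℂ) : Submodule ℂ (EuclideanSpace ℝ (Fin N) → ℂ) where
  carrier := {f | f 0 = 0 ∧ ContDiffOn ℝ ∞ f {0}ᶜ ∧
    ∀ t : ℝ, t ≠ 0 → ∀ X : EuclideanSpace ℝ (Fin N), X ≠ 0 →
      f (t • X) = ((|t| : ℝ) : ℂ) ^ (-μ - (N : ℂ) / 2) * f X}
  zero_mem' := ⟨rfl, contDiffOn_const, fun _ _ _ _ => by simp⟩
  add_mem' := by
    rintro f g ⟨hf0, hf, hf'⟩ ⟨hg0, hg, hg'⟩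
    refine ⟨by simp [hf0, hg0], hf.add hg, fun t ht X hX => ?_⟩
    simp only [Pi.add_apply, hf' t ht X hX, hg' t ht X hX, mul_add]
  smul_mem' := by
    rintro c f ⟨hf0, hf, hf'⟩
    refine ⟨by simp [hf0], hf.const_smul c, fun t ht X hX => ?_⟩
    simp only [Pi.smul_apply, hf' t ht X hX, smul_eq_mul]
    ring

/-- The homogeneous extension `p_z` of degree `z` of the restriction of `p` to the unit sphere:
`p_z (r ω) = r ^ z * p ω` for `r > 0` and `‖ω‖ = 1`. -/
def homogeneousExtension {N : ℕ} (p : EuclideanSpace ℝ (Fin N) → ℂ) (z : ℂ)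
    (x : EuclideanSpace ℝ (Fin N)) : ℂ :=
  (‖x‖ : ℂ) ^ z * p (‖x‖⁻¹ • x)

/-- `T` is the tempered distribution `p_s` defined by the restriction of `p` to the unit sphere
and by the degree of homogeneity `s`, in the sense of meromorphic continuation: for every
test function `φ`, the function `z ↦ ∫ φ(x) p_z(x) dx`, given by a convergent integral for
`Re z > -N` when `p` is continuous on the sphere, extends to a meromorphic function on `ℂ` which
is holomorphic at `s` and whose value there is `T φ`. -/
def IsHomogeneousDistribution {N : ℕ} (p : EuclideanSpace ℝ (Fin N) → ℂ) (s : ℂ)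
    (T : 𝓢'(EuclideanSpace ℝ (Fin N), ℂ)) : Prop :=
  ∀ φ : 𝓢(EuclideanSpace ℝ (Fin N), ℂ), ∃ F : ℂ → ℂ,
    (∀ z, MeromorphicAt F z) ∧
    (∀ z : ℂ, -(N : ℝ) < z.re → F z = ∫ x, φ x * homogeneousExtension p z x) ∧
    AnalyticAt ℂ F s ∧ F s = T φ

/-- `ι` is the embedding by which `V_μ` is regarded as a subspace of the tempered distributions:
it is linear and injective, and `ι f` is the unique tempered distribution attached to `f`, which
is homogeneous of degree `-μ - N/2`, by meromorphic continuation. This determines `ι`. -/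
def IsCanonicalEmbedding (N : ℕ) (μ : ℂ)
    (ι : homogeneousFunctions N μ →ₗ[ℂ] 𝓢'(EuclideanSpace ℝ (Fin N), ℂ)) : Prop :=
  Function.Injective ι ∧
  ∀ (f : homogeneousFunctions N μ) (T : 𝓢'(EuclideanSpace ℝ (Fin N), ℂ)),
    IsHomogeneousDistribution (f : EuclideanSpace ℝ (Fin N) → ℂ) (-μ - (N : ℂ) / 2) T ↔ T = ι f

end

/-!
A homogeneous function of degree `-w` is a radial Mellin transform: for an even Schwartz function
`u`, the function `M_w u (x) = ∫₀^∞ t ^ (w - 1) u (t x) dt` is smooth off the origin, even and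
homogeneous of degree `-w`, and every `f` in the space is of this form, with `u` the product of `f`
and a radial bump function (`exists_regularizedMellin_eq`). For `0 < Re w < N`, Fubini's theorem
gives `∫ M_w u * φ = ∫₀^∞ t ^ (w - 1) a(t) dt` with `a(t) = ∫ u (t x) φ x dx`. Parseval's formula
says that replacing `(u, φ̂)` by `(û, φ)` turns `a(t)` into `t ^ (-N) a(1 / t)`, so the Fourier
transform of `M_w u` is `M_(N - w) û`, which is again smooth off the origin.

Outside that strip all the integrals are continued by one device. The Euler operator
`E = ∑ i, x i * ∂ i` acts on `M_w` as `-w`, and on the pairing with a function homogeneous of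
degree `z` as `-N - z`; and `P_k = ∏ j < k, (E - 2 * j)` turns an even Schwartz function into one
that vanishes at the origin to order `2 * k` (`vanishesToOrder_eulerProd`). Dividing by the
corresponding scalar gives the continuation, holomorphic in `z` off the poles `z = -N - 2 * j`,
which the hypothesis on `μ` excludes; the odd part of a test function does not contribute. Since the
Fourier transform carries `E` to the transpose `-E - N` of `E`, the Parseval identity survives when
`P_k` is applied to both entries (`correlation_eulerProd_fourier`). Hence the functional equation
holds directly in the larger strip, and the scalar factors on its two sides coincide
(`homogeneousPairing_fourier`).

The embedding is unique by the identity theorem for meromorphic functions, and injective because a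
homogeneous distribution is given by integration on test functions supported away from the origin.
Surjectivity of the Fourier transform follows since its square is the reflection, which fixes even
distributions.
-/

open scoped ContDiff FourierTransform SchwartzMap

noncomputable section

open MeasureTheory Set Filter Topology SchwartzMap

/-! ### Vanishing at the origin and the Euler operator -/

namespace SchwartzMap

universe u

variable {E : Type} {F : Type u} [NormedAddCommGroup E] [NormedSpace ℝ E]
  [NormedAddCommGroup F] [NormedSpace ℝ F]

/-- The Schwartz function `u` vanishes at the origin to order `m`: its derivatives of order less
than `m` vanish there. -/
def VanishesToOrder (m : ℕ) (u : 𝓢(E, F)) : Prop :=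
  ∀ i < m, iteratedFDeriv ℝ i u 0 = 0

theorem vanishesToOrder_zero (u : 𝓢(E, F)) : VanishesToOrder 0 u := fun i hi => by omega

theorem norm_iteratedFDeriv_fderivCLM (u : 𝓢(E, F)) (i : ℕ) (x : E) :
    ‖iteratedFDeriv ℝ i (fderivCLM ℝ E F u) x‖ = ‖iteratedFDeriv ℝ (i + 1) u x‖ := by
  rw [← norm_iteratedFDeriv_fderiv]
  rfl

theorem vanishesToOrder_succ {m : ℕ} {u : 𝓢(E, F)} :
    VanishesToOrder (m + 1) u ↔ u 0 = 0 ∧ VanishesToOrder m (fderivCLM ℝ E F u) := by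
  constructor
  · refine fun h => ⟨?_, fun i hi => ?_⟩
    · have := h 0 (by omega)
      rwa [← norm_eq_zero, norm_iteratedFDeriv_zero, norm_eq_zero] at this
    · rw [← norm_eq_zero, norm_iteratedFDeriv_fderivCLM, norm_eq_zero]
      exact h _ (by omega)
  · rintro ⟨h0, h⟩ i hi
    cases i with
    | zero => rwa [← norm_eq_zero, norm_iteratedFDeriv_zero, norm_eq_zero]
    | succ i =>
      rw [← norm_eq_zero, ← norm_iteratedFDeriv_fderivCLM, norm_eq_zero]
      exact h _ (by omega)

theorem seminorm_fderivCLM_le (u : 𝓢(E, F)) (k n : ℕ) :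
    SchwartzMap.seminorm ℝ k n (fderivCLM ℝ E F u) ≤ SchwartzMap.seminorm ℝ k (n + 1) u := by
  refine seminorm_le_bound ℝ k n _ (apply_nonneg _ _) fun x => ?_
  rw [norm_iteratedFDeriv_fderivCLM]
  exact le_seminorm ℝ k (n + 1) u x

/-- Taylor's estimate, by induction on the order through the mean value inequality on the ball of
radius `‖x‖`. -/
theorem VanishesToOrder.norm_le {m : ℕ} {u : 𝓢(E, F)} (h : VanishesToOrder m u) (x : E) :
    ‖u x‖ ≤ ‖x‖ ^ m * SchwartzMap.seminorm ℝ 0 m u := by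
  induction m generalizing F x with
  | zero => simpa using norm_le_seminorm ℝ u x
  | succ m ih =>
    obtain ⟨h0, h1⟩ := vanishesToOrder_succ.1 h
    have key := (convex_closedBall (0 : E) ‖x‖).norm_image_sub_le_of_norm_fderiv_le (𝕜 := ℝ)
      (f := u) (C := ‖x‖ ^ m * SchwartzMap.seminorm ℝ 0 (m + 1) u) (x := 0) (y := x)
      (fun y _ => u.differentiableAt) (fun y hy => ?_) (by simp) (by simp)
    · rw [h0, sub_zero, sub_zero] at key
      refine key.trans (le_of_eq ?_)
      ring
    · rw [mem_closedBall_zero_iff] at hy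
      rw [← fderivCLM_apply (𝕜 := ℝ)]
      refine (ih h1 y).trans ?_
      have := seminorm_fderivCLM_le u 0 m
      gcongr

/-- A Schwartz function vanishing to order `m` at the origin is dominated by
`‖x‖ ^ m / (1 + ‖x‖) ^ (m + l)`, for every `l`. -/
theorem VanishesToOrder.norm_le_div {m : ℕ} {u : 𝓢(E, F)} (h : VanishesToOrder m u) (l : ℕ)
    (x : E) :
    ‖u x‖ ≤ 2 ^ (m + l) * (SchwartzMap.seminorm ℝ 0 m u + SchwartzMap.seminorm ℝ (m + l) 0 u) *
      (‖x‖ ^ m / (1 + ‖x‖) ^ (m + l)) := by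
  have hp : 0 < 1 + ‖x‖ := by positivity
  rw [← mul_div_assoc, le_div_iff₀ (by positivity)]
  have h1 : 0 ≤ SchwartzMap.seminorm ℝ 0 m u := apply_nonneg _ _
  have h2 : 0 ≤ SchwartzMap.seminorm ℝ (m + l) 0 u := apply_nonneg _ _
  -- Near the origin the order of vanishing is used, and far from it the decay at infinity.
  rcases le_total ‖x‖ 1 with hx | hx
  · calc ‖u x‖ * (1 + ‖x‖) ^ (m + l)
        ≤ (‖x‖ ^ m * SchwartzMap.seminorm ℝ 0 m u) * 2 ^ (m + l) := by
          gcongr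
          · exact h.norm_le x
          · linarith
      _ = 2 ^ (m + l) * SchwartzMap.seminorm ℝ 0 m u * ‖x‖ ^ m := by ring
      _ ≤ _ := by gcongr; linarith
  · calc ‖u x‖ * (1 + ‖x‖) ^ (m + l)
        ≤ ‖u x‖ * (2 * ‖x‖) ^ (m + l) := by gcongr; linarith
      _ = 2 ^ (m + l) * (‖x‖ ^ (m + l) * ‖u x‖) * 1 := by rw [mul_pow]; ring
      _ ≤ 2 ^ (m + l) * SchwartzMap.seminorm ℝ (m + l) 0 u * ‖x‖ ^ m := by
          gcongr
          · exact norm_pow_mul_le_seminorm ℝ u (m + l) x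
          · exact one_le_pow₀ hx
      _ ≤ _ := by gcongr; linarith

theorem VanishesToOrder.add {m : ℕ} {u v : 𝓢(E, F)} (hu : VanishesToOrder m u)
    (hv : VanishesToOrder m v) : VanishesToOrder m (u + v) := by
  induction m generalizing F with
  | zero => exact vanishesToOrder_zero _
  | succ m ih =>
    rw [vanishesToOrder_succ] at *
    refine ⟨by simp [hu.1, hv.1], ?_⟩
    rw [map_add]
    exact ih hu.2 hv.2

theorem VanishesToOrder.const_smul {m : ℕ} {u : 𝓢(E, F)} (hu : VanishesToOrder m u) (c : ℝ) :
    VanishesToOrder m (c • u) := by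
  induction m generalizing F with
  | zero => exact vanishesToOrder_zero _
  | succ m ih =>
    rw [vanishesToOrder_succ] at *
    refine ⟨by simp [hu.1], ?_⟩
    rw [map_smul]
    exact ih hu.2

theorem VanishesToOrder.sub {m : ℕ} {u v : 𝓢(E, F)} (hu : VanishesToOrder m u)
    (hv : VanishesToOrder m v) : VanishesToOrder m (u - v) := by
  have := hu.add (hv.const_smul (-1))
  rwa [neg_one_smul, ← sub_eq_add_neg] at this

theorem VanishesToOrder.of_eventuallyEq_zero {u : 𝓢(E, F)} (h : (u : E → F) =ᶠ[nhds 0] 0)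
    (m : ℕ) : VanishesToOrder m u := by
  intro i _
  rw [(h.iteratedFDeriv ℝ i).eq_of_nhds]
  exact congrFun (iteratedFDeriv_fun_zero (𝕜 := ℝ) (n := i)) 0

theorem fderiv_neg_of_parity {u : 𝓢(E, F)} {c : ℝ} (hu : ∀ x, u (-x) = c • u x) (x : E) :
    fderiv ℝ u (-x) = -(c • fderiv ℝ u x) := by
  have h1 : HasFDerivAt (fun y => u (-y)) _ x :=
    (u.hasFDerivAt (-x)).comp x (hasFDerivAt_id x).neg
  have h2 : HasFDerivAt (fun y => u (-y)) (c • fderiv ℝ u x) x := by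
    rw [funext hu]
    exact (u.hasFDerivAt x).const_smul c
  have := h1.unique h2
  rw [← this]
  ext
  simp

/-- A function of parity opposite to that of `m` and vanishing to order `m` also vanishes to order
`m + 1`. -/
theorem VanishesToOrder.succ_of_parity {m : ℕ} {u : 𝓢(E, F)} (h : VanishesToOrder m u)
    (hu : ∀ x, u (-x) = (-1 : ℝ) ^ (m + 1) • u x) : VanishesToOrder (m + 1) u := by
  induction m generalizing F with
  | zero =>
    refine vanishesToOrder_succ.2 ⟨?_, vanishesToOrder_zero _⟩
    have := hu 0
    rw [neg_zero, zero_add, pow_one, neg_one_smul] at this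
    have h2 : (2 : ℝ) • u 0 = 0 := by rw [two_smul]; nth_rw 1 [this]; simp
    simpa using h2
  | succ m ih =>
    obtain ⟨h0, h1⟩ := vanishesToOrder_succ.1 h
    refine vanishesToOrder_succ.2 ⟨h0, ih h1 fun x => ?_⟩
    rw [fderivCLM_apply, fderivCLM_apply, fderiv_neg_of_parity hu, pow_succ _ (m + 1)]
    simp

/-- The Euler operator `u ↦ (x ↦ ∑ i, x i * ∂ i u x)` on Schwartz functions. -/
def euler : 𝓢(E, F) →L[ℝ] 𝓢(E, F) :=
  (bilinLeftCLM (ContinuousLinearMap.id ℝ (E →L[ℝ] F)) Function.HasTemperateGrowth.id').comp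
    (fderivCLM ℝ E F)

theorem euler_apply (u : 𝓢(E, F)) (x : E) : euler u x = fderiv ℝ u x x := rfl

/-- Differentiation lowers the degree of homogeneity by one. -/
theorem fderivCLM_euler (u : 𝓢(E, F)) :
    fderivCLM ℝ E F (euler u) = euler (fderivCLM ℝ E F u) + fderivCLM ℝ E F u := by
  ext x h
  have hd : HasFDerivAt (fun y => fderiv ℝ u y) (fderiv ℝ (fderivCLM ℝ E F u) x) x :=
    (fderivCLM ℝ E F u).hasFDerivAt x
  have h1 : HasFDerivAt (euler u) _ x := hd.clm_apply (hasFDerivAt_id x)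
  have hs : IsSymmSndFDerivAt ℝ u x :=
    (u.contDiffAt 2).isSymmSndFDerivAt (by simp)
  rw [fderivCLM_apply, h1.fderiv]
  have h2 : fderiv ℝ (fderivCLM ℝ E F u) x = fderiv ℝ (fderiv ℝ u) x := rfl
  simp [euler_apply, h2, hs.eq x h, add_comm]

theorem VanishesToOrder.euler {m : ℕ} {u : 𝓢(E, F)} (h : VanishesToOrder m u) :
    VanishesToOrder m (SchwartzMap.euler u) := by
  induction m generalizing F with
  | zero => exact vanishesToOrder_zero _
  | succ m ih =>
    have h' := (vanishesToOrder_succ.1 h).2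
    refine vanishesToOrder_succ.2 ⟨by simp [euler_apply], ?_⟩
    rw [fderivCLM_euler]
    exact (ih h').add h'

/-- The operator `euler - m` annihilates the homogeneous terms of degree `m` of the Taylor
expansion at the origin. -/
theorem VanishesToOrder.euler_sub {m : ℕ} {u : 𝓢(E, F)} (h : VanishesToOrder m u) :
    VanishesToOrder (m + 1) (SchwartzMap.euler u - (m : ℝ) • u) := by
  induction m generalizing F with
  | zero =>
    refine vanishesToOrder_succ.2 ⟨by simp [euler_apply], vanishesToOrder_zero _⟩
  | succ m ih =>
    obtain ⟨h0, h1⟩ := vanishesToOrder_succ.1 h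
    refine vanishesToOrder_succ.2 ⟨by simp [euler_apply, h0], ?_⟩
    rw [map_sub, map_smul, fderivCLM_euler]
    convert ih h1 using 1
    push_cast
    module

theorem euler_even {u : 𝓢(E, F)} (hu : ∀ x, u (-x) = u x) (x : E) : euler u (-x) = euler u x := by
  rw [euler_apply, euler_apply, fderiv_neg_of_parity (c := 1) (fun y => by simp [hu y])]
  simp

/-- The operator `∏ j < k, (euler - 2 * j)`. -/
def eulerProd : ℕ → (𝓢(E, F) →L[ℝ] 𝓢(E, F))
  | 0 => ContinuousLinearMap.id ℝ _
  | k + 1 => (euler - (2 * k : ℝ) • ContinuousLinearMap.id ℝ _).comp (eulerProd k)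

theorem eulerProd_zero (u : 𝓢(E, F)) : eulerProd 0 u = u := rfl

theorem eulerProd_succ (k : ℕ) (u : 𝓢(E, F)) :
    eulerProd (k + 1) u = euler (eulerProd k u) - (2 * k : ℝ) • eulerProd k u := rfl

theorem eulerProd_euler (k : ℕ) (u : 𝓢(E, F)) :
    eulerProd k (euler u) = euler (eulerProd k u) := by
  induction k with
  | zero => rfl
  | succ k ih => simp only [eulerProd_succ, ih, map_sub, map_smul]

theorem eulerProd_even (k : ℕ) {u : 𝓢(E, F)} (hu : ∀ x, u (-x) = u x) (x : E) :
    eulerProd k u (-x) = eulerProd k u x := by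
  induction k generalizing x with
  | zero => exact hu x
  | succ k ih => simp [eulerProd_succ, euler_even ih, ih]

theorem VanishesToOrder.eulerProd {m : ℕ} {u : 𝓢(E, F)} (h : VanishesToOrder m u) (k : ℕ) :
    VanishesToOrder m (SchwartzMap.eulerProd k u) := by
  induction k with
  | zero => exact h
  | succ k ih => exact ih.euler.sub (ih.const_smul _)

/-- For even `u`, each factor of `eulerProd k` removes one homogeneous term of the Taylor expansion
at the origin, and the terms of odd degree are absent. -/
theorem vanishesToOrder_eulerProd (k : ℕ) {u : 𝓢(E, F)} (hu : ∀ x, u (-x) = u x) :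
    VanishesToOrder (2 * k) (eulerProd k u) := by
  induction k with
  | zero => exact vanishesToOrder_zero _
  | succ k ih =>
    have h1 : VanishesToOrder (2 * k + 1) (SchwartzMap.eulerProd (k + 1) u) := by
      have := ih.euler_sub
      push_cast at this
      exact this
    refine h1.succ_of_parity fun x => ?_
    rw [eulerProd_even _ hu, show (-1 : ℝ) ^ (2 * k + 1 + 1) = 1 from
      Even.neg_one_pow ⟨k + 1, by ring⟩, one_smul]

end SchwartzMap

/-! ### Radial Mellin transforms -/

/-- The weight `r ^ m / (1 + r) ^ (m + l)`, of order `r ^ m` at `0` and `r ^ (-l)` at infinity. -/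
def radialWeight (m l : ℕ) (r : ℝ) : ℝ := r ^ m / (1 + r) ^ (m + l)

theorem radialWeight_nonneg (m l : ℕ) {r : ℝ} (hr : 0 ≤ r) : 0 ≤ radialWeight m l r := by
  unfold radialWeight; positivity

theorem measurable_radialWeight (m l : ℕ) : Measurable (radialWeight m l) := by
  unfold radialWeight; fun_prop

theorem continuousOn_radialWeight (m l : ℕ) : ContinuousOn (radialWeight m l) (Ioi 0) := by
  unfold radialWeight
  refine ContinuousOn.div (by fun_prop) (by fun_prop) fun r hr => ?_
  have : (0 : ℝ) < r := hr
  positivity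

theorem radialWeight_mul_le (m l : ℕ) {b B c r : ℝ} (hb : 0 < b) (hbc : b ≤ c) (hcB : c ≤ B)
    (hr : 0 ≤ r) :
    radialWeight m l (c * r) ≤ B ^ m * ((min 1 b) ^ (m + l))⁻¹ * radialWeight m l r := by
  have hc : 0 < c := hb.trans_le hbc
  have hm : 0 < min 1 b := lt_min one_pos hb
  have h1 : min 1 b * (1 + r) ≤ 1 + c * r := by
    have h2 := min_le_left 1 b
    have h3 : min 1 b * r ≤ c * r := by gcongr; exact (min_le_right 1 b).trans hbc
    linarith
  unfold radialWeight
  calc (c * r) ^ m / (1 + c * r) ^ (m + l)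
      ≤ (B * r) ^ m / (min 1 b * (1 + r)) ^ (m + l) := by
        have : 0 ≤ B := hc.le.trans hcB
        gcongr
    _ = _ := by rw [mul_pow, mul_pow]; field_simp

theorem integrableOn_rpow_mul_radialWeight {m l : ℕ} {a : ℝ} (h1 : -(m : ℝ) < a)
    (h2 : a < l) : IntegrableOn (fun r : ℝ => r ^ (a - 1) * radialWeight m l r) (Ioi 0) := by
  refine mellin_convergent_of_isBigO_scalar (a := l) (b := -(m : ℝ))
    ((continuousOn_radialWeight m l).locallyIntegrableOn measurableSet_Ioi) ?_ h2 ?_ h1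
  · refine Asymptotics.IsBigO.of_bound 1 ?_
    filter_upwards [eventually_gt_atTop 0] with r hr
    rw [one_mul, Real.norm_of_nonneg (radialWeight_nonneg m l hr.le),
      Real.norm_of_nonneg (by positivity), Real.rpow_neg hr.le, Real.rpow_natCast]
    unfold radialWeight
    rw [div_le_iff₀ (by positivity), inv_mul_eq_div, le_div_iff₀ (by positivity), ← pow_add]
    gcongr
    linarith
  · refine Asymptotics.IsBigO.of_bound 1 ?_
    filter_upwards [self_mem_nhdsWithin] with r hr
    have hr : 0 < r := hr
    rw [one_mul, Real.norm_of_nonneg (radialWeight_nonneg m l hr.le), neg_neg,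
      Real.rpow_natCast, Real.norm_of_nonneg (by positivity)]
    exact div_le_self (by positivity) (one_le_pow₀ (by linarith))

theorem integral_rpow_mul_radialWeight_mul (m l : ℕ) (a : ℝ) {c : ℝ} (hc : 0 < c) :
    ∫ r in Ioi (0 : ℝ), r ^ (a - 1) * radialWeight m l (r * c) =
      c ^ (-a) * ∫ r in Ioi (0 : ℝ), r ^ (a - 1) * radialWeight m l r := by
  have h := integral_comp_mul_right_Ioi (fun r => r ^ (a - 1) * radialWeight m l r) 0 hc
  rw [zero_mul] at h
  have h2 : ∫ r in Ioi (0 : ℝ), (r * c) ^ (a - 1) * radialWeight m l (r * c) =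
      c ^ (a - 1) * ∫ r in Ioi (0 : ℝ), r ^ (a - 1) * radialWeight m l (r * c) := by
    rw [← integral_const_mul]
    refine setIntegral_congr_fun measurableSet_Ioi fun r hr => ?_
    have hr : 0 < r := hr
    rw [Real.mul_rpow hr.le hc.le]
    ring
  rw [h2, smul_eq_mul] at h
  have h3 : c ^ (a - 1) ≠ 0 := (Real.rpow_pos_of_pos hc _).ne'
  rw [← mul_right_inj' h3, h, ← mul_assoc, ← Real.rpow_add hc, ← Real.rpow_neg_one]
  congr 2
  ring

theorem integrable_norm_rpow_mul_radialWeight {E : Type*} [NormedAddCommGroup E]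
    [NormedSpace ℝ E] [Nontrivial E] [FiniteDimensional ℝ E] [MeasurableSpace E] [BorelSpace E]
    (μ : Measure E) [μ.IsAddHaarMeasure] {m l : ℕ} {a : ℝ}
    (h1 : -(Module.finrank ℝ E : ℝ) - m < a) (h2 : a + Module.finrank ℝ E < l) :
    Integrable (fun x : E => ‖x‖ ^ a * radialWeight m l ‖x‖) μ := by
  rw [integrable_fun_norm_addHaar μ (f := fun r : ℝ => r ^ a * radialWeight m l r)]
  refine (integrableOn_rpow_mul_radialWeight (m := m) (l := l)
    (a := a + Module.finrank ℝ E) (by linarith) h2).congr_fun (fun r hr => ?_) measurableSet_Ioi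
  have hr : 0 < r := hr
  simp only [smul_eq_mul]
  rw [← mul_assoc, ← Real.rpow_natCast, ← Real.rpow_add hr]
  congr 2
  rw [Nat.cast_sub Module.finrank_pos]
  push_cast
  ring

namespace SchwartzMap

universe u

variable {E : Type} {F : Type u} [NormedAddCommGroup E] [NormedSpace ℝ E]
  [NormedAddCommGroup F] [NormedSpace ℝ F]

theorem VanishesToOrder.exists_norm_le {m : ℕ} {u : 𝓢(E, F)} (h : VanishesToOrder m u) (l : ℕ) :
    ∃ C, 0 ≤ C ∧ ∀ x, ‖u x‖ ≤ C * radialWeight m l ‖x‖ :=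
  ⟨_, mul_nonneg (by positivity) (add_nonneg (apply_nonneg _ _) (apply_nonneg _ _)),
    h.norm_le_div l⟩

theorem VanishesToOrder.exists_norm_smul_le {m : ℕ} {u : 𝓢(E, F)} (h : VanishesToOrder m u)
    (l : ℕ) {b B : ℝ} (hb : 0 < b) :
    ∃ C, 0 ≤ C ∧ ∀ t : ℝ, 0 ≤ t → ∀ x : E, b ≤ ‖x‖ → ‖x‖ ≤ B →
      ‖u (t • x)‖ ≤ C * radialWeight m l t := by
  obtain ⟨C, hC, hu⟩ := h.exists_norm_le l
  refine ⟨C * ((max B 0) ^ m * ((min 1 b) ^ (m + l))⁻¹), by positivity, fun t ht x h1 h2 => ?_⟩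
  refine (hu _).trans ?_
  rw [mul_assoc, norm_smul, Real.norm_of_nonneg ht, mul_comm t]
  gcongr
  exact radialWeight_mul_le m l hb h1 (h2.trans (le_max_left _ _)) ht

/-- The radial Mellin transform `∫₀^∞ t ^ (w - 1) u (t x) dt`, a function of `x ≠ 0` homogeneous
of degree `-w`. -/
def radialMellin (w : ℂ) (u : 𝓢(E, ℂ)) (x : E) : ℂ := mellin (fun t : ℝ => u (t • x)) w

theorem norm_ofReal_cpow_sub_one {t : ℝ} (ht : 0 < t) (w : ℂ) :
    ‖(t : ℂ) ^ (w - 1)‖ = t ^ (w.re - 1) := by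
  rw [Complex.norm_cpow_eq_rpow_re_of_pos ht]; simp

theorem aestronglyMeasurable_cpow_smul {G : Type*} [NormedAddCommGroup G] [NormedSpace ℂ G]
    {u : ℝ → G} (hu : Continuous u) (w : ℂ) :
    AEStronglyMeasurable (fun t : ℝ => (t : ℂ) ^ w • u t) (volume.restrict (Ioi 0)) := by
  refine ContinuousOn.aestronglyMeasurable (fun t ht => ?_) measurableSet_Ioi
  have ht : 0 < t := ht
  exact ((Complex.continuousAt_ofReal_cpow_const t w (Or.inr ht.ne')).smul
    hu.continuousAt).continuousWithinAt

theorem mellinConvergent_smul {m : ℕ} {u : 𝓢(E, ℂ)} (h : VanishesToOrder m u) {w : ℂ}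
    (hw : -(m : ℝ) < w.re) {x : E} (hx : x ≠ 0) :
    MellinConvergent (fun t : ℝ => u (t • x)) w := by
  obtain ⟨l, hl⟩ := exists_nat_gt w.re
  obtain ⟨C, hC, hu⟩ := h.exists_norm_smul_le l (B := ‖x‖) (norm_pos_iff.2 hx)
  refine Integrable.mono' ((integrableOn_rpow_mul_radialWeight hw hl).const_mul C)
    (aestronglyMeasurable_cpow_smul (by fun_prop) _) ?_
  refine (ae_restrict_iff' measurableSet_Ioi).2 (.of_forall fun t ht => ?_)
  have ht : 0 < t := ht
  rw [norm_smul, norm_ofReal_cpow_sub_one ht]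
  calc _ ≤ t ^ (w.re - 1) * (C * radialWeight m l t) := by
        gcongr
        exact hu t ht.le x le_rfl le_rfl
    _ = _ := by ring

theorem radialMellin_smul (w : ℂ) (u : 𝓢(E, ℂ)) {c : ℝ} (hc : 0 < c) (x : E) :
    radialMellin w u (c • x) = (c : ℂ) ^ (-w) * radialMellin w u x := by
  have := mellin_comp_mul_right (fun t : ℝ => u (t • x)) w hc
  simp only [mul_smul] at this
  exact this

theorem radialMellin_neg {u : 𝓢(E, ℂ)} (hu : ∀ x, u (-x) = u x) (w : ℂ) (x : E) :
    radialMellin w u (-x) = radialMellin w u x := by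
  simp [radialMellin, hu]

theorem VanishesToOrder.exists_fderivCLM {m : ℕ} {u : 𝓢(E, F)} (h : VanishesToOrder m u) {a : ℝ}
    (ha : -(m : ℝ) < a) : ∃ n : ℕ, -(n : ℝ) < a + 1 ∧ VanishesToOrder n (fderivCLM ℝ E F u) := by
  cases m with
  | zero => exact ⟨0, by push_cast at *; linarith, vanishesToOrder_zero _⟩
  | succ m => exact ⟨m, by push_cast at *; linarith, (vanishesToOrder_succ.1 h).2⟩

/-- Differentiation under the integral sign: the derivative of the radial Mellin transform at `w` is
the radial Mellin transform at `w + 1` of the derivative. The order of vanishing drops by one, which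
the shift of `w` makes up for. -/
theorem hasFDerivAt_radialMellin {m : ℕ} {u : 𝓢(E, ℂ)} (h : VanishesToOrder m u) {w : ℂ}
    (hw : -(m : ℝ) < w.re) {x : E} (hx : x ≠ 0) :
    ∃ L : E →L[ℝ] ℂ, HasFDerivAt (radialMellin w u) L x ∧
      ∀ y, L y = mellin (fun t => fderiv ℝ u (t • x) y) (w + 1) := by
  obtain ⟨n, hn, hD⟩ := h.exists_fderivCLM hw
  obtain ⟨l, hl⟩ := exists_nat_gt (w.re + 1)
  have hx' : 0 < ‖x‖ := norm_pos_iff.2 hx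
  obtain ⟨C, hC, hu⟩ := hD.exists_norm_smul_le l (b := ‖x‖ / 2) (B := 2 * ‖x‖) (by positivity)
  have hball : ∀ y ∈ Metric.ball x (‖x‖ / 2), ‖x‖ / 2 ≤ ‖y‖ ∧ ‖y‖ ≤ 2 * ‖x‖ := by
    intro y hy
    rw [mem_ball_iff_norm] at hy
    have h1 := norm_sub_norm_le x y
    have h2 := norm_sub_norm_le y x
    rw [norm_sub_rev] at h1
    constructor <;> linarith
  set F' : E → ℝ → E →L[ℝ] ℂ := fun y t => (t : ℂ) ^ (w - 1) • (t • fderivCLM ℝ E ℂ u (t • y))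
  have hmeas : ∀ y, AEStronglyMeasurable (F' y) (volume.restrict (Ioi 0)) := fun y =>
    aestronglyMeasurable_cpow_smul (u := fun t : ℝ => t • fderivCLM ℝ E ℂ u (t • y))
      (by fun_prop) _
  have hint := integrableOn_rpow_mul_radialWeight (m := n) (l := l) (a := w.re + 1) hn hl
  have hbound : ∀ t ∈ Ioi (0 : ℝ), ∀ y ∈ Metric.ball x (‖x‖ / 2),
      ‖F' y t‖ ≤ C * (t ^ (w.re + 1 - 1) * radialWeight n l t) := by
    intro t ht y hy
    have ht : 0 < t := ht
    obtain ⟨h1, h2⟩ := hball y hy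
    rw [norm_smul, norm_smul, norm_ofReal_cpow_sub_one ht, Real.norm_of_nonneg ht.le, ← mul_assoc,
      ← Real.rpow_add_one ht.ne', sub_add_cancel, add_sub_cancel_right]
    calc _ ≤ t ^ w.re * (C * radialWeight n l t) := by
          gcongr
          exact hu t ht.le y h1 h2
      _ = _ := by ring
  have key := hasFDerivAt_integral_of_dominated_of_fderiv_le (𝕜 := ℝ)
    (μ := volume.restrict (Ioi (0 : ℝ))) (F := fun y t => (t : ℂ) ^ (w - 1) • u (t • y))
    (F' := F') (x₀ := x) (s := Metric.ball x (‖x‖ / 2))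
    (bound := fun t => C * (t ^ (w.re + 1 - 1) * radialWeight n l t))
    (Metric.ball_mem_nhds _ (by positivity))
    (.of_forall fun y => aestronglyMeasurable_cpow_smul (by fun_prop) _)
    (mellinConvergent_smul h hw hx) (hmeas x)
    ((ae_restrict_iff' measurableSet_Ioi).2 (.of_forall hbound)) (hint.const_mul C) ?_
  · refine ⟨_, key, fun y => ?_⟩
    have hF'int : Integrable (F' x) (volume.restrict (Ioi 0)) :=
      Integrable.mono' (hint.const_mul C) (hmeas x) ((ae_restrict_iff' measurableSet_Ioi).2
        (.of_forall fun t ht => hbound t ht x (Metric.mem_ball_self (by positivity))))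
    rw [ContinuousLinearMap.integral_apply hF'int]
    refine setIntegral_congr_fun measurableSet_Ioi fun t ht => ?_
    have ht : (t : ℂ) ≠ 0 := by exact_mod_cast (ne_of_gt ht)
    simp only [F', smul_apply, fderivCLM_apply, add_sub_cancel_right]
    rw [Complex.cpow_sub _ _ ht, Complex.cpow_one]
    simp only [smul_eq_mul, Complex.real_smul]
    field_simp
  · refine .of_forall fun t y _ => ?_
    have h1 : HasFDerivAt (fun y : E => t • y) (t • ContinuousLinearMap.id ℝ E) y :=
      (hasFDerivAt_id y).const_smul t
    have h2 : HasFDerivAt (fun y : E => u (t • y)) (t • fderivCLM ℝ E ℂ u (t • y)) y := by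
      have h3 := (u.hasFDerivAt (t • y)).comp y h1
      have h4 : (fderiv ℝ u (t • y)).comp (t • ContinuousLinearMap.id ℝ E) =
          t • fderivCLM ℝ E ℂ u (t • y) := by
        ext; simp
      rwa [h4] at h3
    exact h2.fun_const_smul ((t : ℂ) ^ (w - 1))

/-- Euler's identity: the value at `x` of the derivative of a function homogeneous of degree `-w` in
the direction `x`. -/
theorem radialMellin_euler {m : ℕ} {u : 𝓢(E, ℂ)} (h : VanishesToOrder m u) {w : ℂ}
    (hw : -(m : ℝ) < w.re) {x : E} (hx : x ≠ 0) :
    radialMellin w (euler u) x = -w * radialMellin w u x := by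
  obtain ⟨L, hL, hL'⟩ := hasFDerivAt_radialMellin h hw hx
  have h1 : HasDerivAt (fun c : ℝ => c • x) x 1 := by
    simpa using (hasDerivAt_id (1 : ℝ)).smul_const x
  have h2 : HasDerivAt (fun c : ℝ => radialMellin w u (c • x)) (L x) 1 := by
    rw [← one_smul ℝ x] at hL
    exact hL.comp_hasDerivAt (1 : ℝ) h1
  have h3 : HasDerivAt (fun c : ℝ => (c : ℂ) ^ (-w) * radialMellin w u x)
      (-w * radialMellin w u x) 1 := by
    have h4 : HasDerivAt (fun c : ℂ => c ^ (-w)) (-w) ((1 : ℝ) : ℂ) := by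
      have := (hasDerivAt_id (1 : ℂ)).cpow_const (c := -w) (by simp)
      simpa using this
    exact h4.comp_ofReal.mul_const _
  have h5 : L x = -w * radialMellin w u x := by
    refine h2.unique (h3.congr_of_eventuallyEq ?_)
    filter_upwards [lt_mem_nhds (show (0 : ℝ) < 1 by norm_num)] with c hc
    exact radialMellin_smul w u hc x
  rw [← h5, hL', radialMellin]
  refine setIntegral_congr_fun measurableSet_Ioi fun t ht => ?_
  have ht : (t : ℂ) ≠ 0 := by exact_mod_cast (ne_of_gt ht)
  simp only [euler_apply, map_smul, add_sub_cancel_right]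
  rw [Complex.cpow_sub _ _ ht, Complex.cpow_one]
  simp only [smul_eq_mul, Complex.real_smul]
  field_simp

theorem radialMellin_eulerProd {m : ℕ} {u : 𝓢(E, ℂ)} (h : VanishesToOrder m u) {w : ℂ}
    (hw : -(m : ℝ) < w.re) (k : ℕ) {x : E} (hx : x ≠ 0) :
    radialMellin w (eulerProd k u) x =
      (∏ j ∈ Finset.range k, (-w - 2 * j)) * radialMellin w u x := by
  induction k with
  | zero => simp [eulerProd_zero]
  | succ k ih =>
    have hk := h.eulerProd k
    rw [Finset.prod_range_succ, eulerProd_succ]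
    have h1 := mellinConvergent_smul hk.euler hw hx
    have h2 := mellinConvergent_smul hk hw hx
    have h3 : radialMellin w (euler (eulerProd k u) - (2 * k : ℝ) • eulerProd k u) x =
        radialMellin w (euler (eulerProd k u)) x -
          (2 * k : ℂ) * radialMellin w (eulerProd k u) x := by
      simp only [radialMellin, mellin]
      rw [← integral_const_mul, ← integral_sub h1 (h2.const_mul _)]
      refine integral_congr_ae (.of_forall fun t => ?_)
      simp only [sub_apply, smul_apply, smul_eq_mul, Complex.real_smul]
      push_cast
      ring
    rw [h3, radialMellin_euler hk hw hx, ih]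
    ring

theorem contDiffOn_radialMellin [FiniteDimensional ℝ E] {m : ℕ} {u : 𝓢(E, ℂ)}
    (h : VanishesToOrder m u) {w : ℂ} (hw : -(m : ℝ) < w.re) :
    ContDiffOn ℝ ∞ (radialMellin w u) {0}ᶜ := by
  refine contDiffOn_infty.2 fun n => ?_
  induction n generalizing m u w with
  | zero =>
    refine contDiffOn_zero.2 fun x hx => ?_
    obtain ⟨L, hL, -⟩ := hasFDerivAt_radialMellin h hw hx
    exact hL.continuousAt.continuousWithinAt
  | succ n ih =>
    push_cast
    rw [contDiffOn_succ_iff_fderiv_of_isOpen isOpen_compl_singleton]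
    refine ⟨fun x hx => ?_, by simp, ?_⟩
    · obtain ⟨L, hL, -⟩ := hasFDerivAt_radialMellin h hw hx
      exact hL.differentiableAt.differentiableWithinAt
    · refine contDiffOn_clm_apply.2 fun y => ?_
      obtain ⟨k, hk, hD⟩ := h.exists_fderivCLM hw
      have hv : VanishesToOrder k (SchwartzMap.evalCLM ℝ E ℂ y (fderivCLM ℝ E ℂ u)) := by
        intro i hi
        have hT : ((SchwartzMap.evalCLM ℝ E ℂ y (fderivCLM ℝ E ℂ u) : 𝓢(E, ℂ)) : E → ℂ) =
          (ContinuousLinearMap.apply ℝ ℂ y) ∘ (fderivCLM ℝ E ℂ u) := rfl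
        rw [hT, ContinuousLinearMap.iteratedFDeriv_comp_left _
          ((fderivCLM ℝ E ℂ u).contDiffAt i) (by exact_mod_cast le_rfl), hD i hi]
        ext; simp
      refine (ih hv (w := w + 1) (by simpa using hk)).congr fun x hx => ?_
      obtain ⟨L, hL, hL'⟩ := hasFDerivAt_radialMellin h hw hx
      rw [hL.fderiv, hL']
      rfl

end SchwartzMap

/-! ### Pairing with homogeneous functions -/

theorem rpow_le_rpow_add_rpow {r a b c : ℝ} (hr : 0 < r) (h1 : a ≤ b) (h2 : b ≤ c) :
    r ^ b ≤ r ^ a + r ^ c := by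
  rcases le_total r 1 with h | h
  · exact (Real.rpow_le_rpow_of_exponent_ge hr h h1).trans
      (le_add_of_nonneg_right (Real.rpow_nonneg hr.le _))
  · exact (Real.rpow_le_rpow_of_exponent_le h h2).trans
      (le_add_of_nonneg_left (Real.rpow_nonneg hr.le _))

section

variable {N : ℕ}

/-- Continuous even functions on `ℝ^N ∖ {0}`, extended by zero: the data on the sphere that
homogeneous distributions are built from. -/
structure IsEvenOffZero (p : EuclideanSpace ℝ (Fin N) → ℂ) : Prop where
  zero : p 0 = 0
  continuousOn : ContinuousOn p {0}ᶜ
  even : ∀ x, p (-x) = p x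

theorem IsEvenOffZero.exists_norm_le {p : EuclideanSpace ℝ (Fin N) → ℂ} (hp : IsEvenOffZero p) :
    ∃ C, 0 ≤ C ∧ ∀ z x, ‖homogeneousExtension p z x‖ ≤ C * ‖x‖ ^ z.re := by
  obtain ⟨C, hC⟩ :=
    (isCompact_sphere (0 : EuclideanSpace ℝ (Fin N)) 1).exists_bound_of_continuousOn
    (hp.continuousOn.mono fun x hx => by
      rintro rfl
      simp at hx)
  refine ⟨max C 0, le_max_right _ _, fun z x => ?_⟩
  rcases eq_or_ne x 0 with rfl | hx
  · simp only [homogeneousExtension, smul_zero, hp.zero, mul_zero, norm_zero]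
    positivity
  · have hx' : 0 < ‖x‖ := norm_pos_iff.2 hx
    rw [homogeneousExtension, norm_mul, Complex.norm_cpow_eq_rpow_re_of_pos hx', mul_comm]
    gcongr
    refine (hC _ ?_).trans (le_max_left _ _)
    rw [mem_sphere_zero_iff_norm, norm_smul, norm_inv, norm_norm, inv_mul_cancel₀ hx'.ne']

theorem homogeneousExtension_smul (p : EuclideanSpace ℝ (Fin N) → ℂ) (z : ℂ) {c : ℝ} (hc : 0 < c)
    (x : EuclideanSpace ℝ (Fin N)) :
    homogeneousExtension p z (c • x) = (c : ℂ) ^ z * homogeneousExtension p z x := by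
  have h : ‖c • x‖⁻¹ • c • x = ‖x‖⁻¹ • x := by
    rw [norm_smul, Real.norm_of_nonneg hc.le, smul_smul]
    congr 1
    field_simp
  rw [homogeneousExtension, homogeneousExtension, h, norm_smul, Real.norm_of_nonneg hc.le,
    Complex.ofReal_mul, Complex.mul_cpow_ofReal_nonneg hc.le (norm_nonneg _), mul_assoc]

theorem IsEvenOffZero.homogeneousExtension_neg {p : EuclideanSpace ℝ (Fin N) → ℂ}
    (hp : IsEvenOffZero p) (z : ℂ) (x : EuclideanSpace ℝ (Fin N)) :
    homogeneousExtension p z (-x) = homogeneousExtension p z x := by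
  rw [homogeneousExtension, homogeneousExtension, norm_neg, smul_neg, hp.even]

theorem IsEvenOffZero.continuousOn_homogeneousExtension {p : EuclideanSpace ℝ (Fin N) → ℂ}
    (hp : IsEvenOffZero p) (z : ℂ) : ContinuousOn (homogeneousExtension p z) {0}ᶜ := by
  intro x hx
  have hx' : 0 < ‖x‖ := norm_pos_iff.2 hx
  have h1 : ContinuousAt (fun y : EuclideanSpace ℝ (Fin N) => (‖y‖ : ℂ) ^ z) x :=
    (Complex.continuousAt_ofReal_cpow_const ‖x‖ z (Or.inr hx'.ne')).comp
      (f := fun y : EuclideanSpace ℝ (Fin N) => ‖y‖) continuous_norm.continuousAt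
  have h2 : ContinuousAt (fun y : EuclideanSpace ℝ (Fin N) => ‖y‖⁻¹ • y) x :=
    (continuous_norm.continuousAt.inv₀ hx'.ne').smul continuousAt_id
  have h3 : ContinuousAt p (‖x‖⁻¹ • x) := by
    refine (hp.continuousOn _ ?_).continuousAt (isOpen_compl_singleton.mem_nhds ?_) <;>
    · simpa using hx
  exact (h1.mul (ContinuousAt.comp (f := fun y : EuclideanSpace ℝ (Fin N) => ‖y‖⁻¹ • y)
    h3 h2)).continuousWithinAt

variable [NeZero N]

theorem IsEvenOffZero.aestronglyMeasurable {p : EuclideanSpace ℝ (Fin N) → ℂ}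
    (hp : IsEvenOffZero p) (z : ℂ) : AEStronglyMeasurable (homogeneousExtension p z) volume := by
  have := (hp.continuousOn_homogeneousExtension z).aestronglyMeasurable (μ := volume)
    isOpen_compl_singleton.measurableSet
  rwa [Measure.restrict_eq_self_of_ae_mem (by simp [ae_iff])] at this

theorem integrable_norm_rpow_mul_radialWeight_euclidean {m l : ℕ} {a : ℝ}
    (h1 : -(N : ℝ) - m < a) (h2 : a + N < l) :
    Integrable (fun x : EuclideanSpace ℝ (Fin N) => ‖x‖ ^ a * radialWeight m l ‖x‖) := by
  apply integrable_norm_rpow_mul_radialWeight <;> rwa [finrank_euclideanSpace_fin]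

/-- The bound involves two Schwartz seminorms of the test function only, which is what makes the
pairing continuous. -/
theorem IsEvenOffZero.exists_bound {p : EuclideanSpace ℝ (Fin N) → ℂ} (hp : IsEvenOffZero p)
    {m : ℕ} {z : ℂ} (hz : -(N : ℝ) - m < z.re) : ∃ l : ℕ, ∃ K, 0 ≤ K ∧
    ∀ u : 𝓢(EuclideanSpace ℝ (Fin N), ℂ), VanishesToOrder m u →
      Integrable (fun x => u x * homogeneousExtension p z x) ∧
      ‖∫ x, u x * homogeneousExtension p z x‖ ≤
        K * (SchwartzMap.seminorm ℝ 0 m u + SchwartzMap.seminorm ℝ (m + l) 0 u) := by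
  obtain ⟨l, hl⟩ := exists_nat_gt (z.re + N)
  obtain ⟨C, hC, hpC⟩ := hp.exists_norm_le
  have hint := integrable_norm_rpow_mul_radialWeight_euclidean (N := N) (l := l) hz hl
  set W := ∫ x : EuclideanSpace ℝ (Fin N), ‖x‖ ^ z.re * radialWeight m l ‖x‖
  have hW : 0 ≤ W := integral_nonneg fun x =>
    mul_nonneg (by positivity) (radialWeight_nonneg _ _ (norm_nonneg _))
  refine ⟨l, C * 2 ^ (m + l) * W, by positivity, fun u hu => ?_⟩
  set S := SchwartzMap.seminorm ℝ 0 m u + SchwartzMap.seminorm ℝ (m + l) 0 u with hS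
  have hS0 : 0 ≤ S := add_nonneg (apply_nonneg _ _) (apply_nonneg _ _)
  have hb : ∀ x, ‖u x * homogeneousExtension p z x‖ ≤
      C * 2 ^ (m + l) * S * (‖x‖ ^ z.re * radialWeight m l ‖x‖) := by
    intro x
    rw [norm_mul]
    calc _ ≤ (2 ^ (m + l) * S * radialWeight m l ‖x‖) * (C * ‖x‖ ^ z.re) := by
          gcongr
          · exact mul_nonneg (by positivity) (radialWeight_nonneg _ _ (norm_nonneg _))
          · exact hu.norm_le_div l x
          · exact hpC z x
      _ = _ := by ring
  have hi := hint.const_mul (C * 2 ^ (m + l) * S)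
  refine ⟨hi.mono' (u.continuous.aestronglyMeasurable.mul (hp.aestronglyMeasurable z))
    (.of_forall hb), ?_⟩
  refine (norm_integral_le_of_norm_le hi (.of_forall hb)).trans (le_of_eq ?_)
  rw [integral_const_mul]
  ring

theorem IsEvenOffZero.integrable {p : EuclideanSpace ℝ (Fin N) → ℂ} (hp : IsEvenOffZero p)
    {m : ℕ} {z : ℂ} (hz : -(N : ℝ) - m < z.re) {u : 𝓢(EuclideanSpace ℝ (Fin N), ℂ)}
    (hu : VanishesToOrder m u) : Integrable (fun x => u x * homogeneousExtension p z x) := by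
  obtain ⟨l, K, -, h⟩ := hp.exists_bound hz
  exact (h u hu).1

/-- Euler's identity for the pairing with a homogeneous function of degree `z`: the transpose of
the Euler operator acts on it as `-N - z`. -/
theorem IsEvenOffZero.integral_euler {p : EuclideanSpace ℝ (Fin N) → ℂ} (hp : IsEvenOffZero p)
    {m : ℕ} {z : ℂ} (hz : -(N : ℝ) - m < z.re) {u : 𝓢(EuclideanSpace ℝ (Fin N), ℂ)}
    (hu : VanishesToOrder m u) :
    ∫ x, euler u x * homogeneousExtension p z x =
      (-(N : ℂ) - z) * ∫ x, u x * homogeneousExtension p z x := by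
  obtain ⟨l, hl⟩ := exists_nat_gt (z.re + N)
  obtain ⟨C, hC, hpC⟩ := hp.exists_norm_le
  obtain ⟨C', hC', huC⟩ := hu.euler.exists_norm_le l
  have hint := integrable_norm_rpow_mul_radialWeight_euclidean (N := N) (l := l) hz hl
  set B : ℝ := 2 ^ m * ((min 1 (1 / 2)) ^ (m + l))⁻¹
  set F : ℝ → EuclideanSpace ℝ (Fin N) → ℂ := fun c x => u (c • x) * homogeneousExtension p z x
  set F' : ℝ → EuclideanSpace ℝ (Fin N) → ℂ := fun c x =>
    ((c⁻¹ : ℝ) : ℂ) * euler u (c • x) * homogeneousExtension p z x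
  have hball : ∀ c ∈ Metric.ball (1 : ℝ) (1 / 2), 1 / 2 ≤ c ∧ c ≤ 2 := by
    intro c hc
    rw [Real.ball_eq_Ioo] at hc
    exact ⟨by linarith [hc.1], by linarith [hc.2]⟩
  -- The integral of the dilated test function is computed in two ways, by differentiation under the
  -- integral sign and by a change of variables, and the derivatives at `c = 1` are compared.
  have key : HasDerivAt (fun c => ∫ x, F c x) (∫ x, F' 1 x) 1 := by
    refine (hasDerivAt_integral_of_dominated_loc_of_deriv_le (s := Metric.ball (1 : ℝ) (1 / 2))
      (bound := fun x => 2 * C' * B * C * (‖x‖ ^ z.re * radialWeight m l ‖x‖))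
      (Metric.ball_mem_nhds _ (by norm_num)) (.of_forall fun c => ?_) ?_ ?_
      (.of_forall fun x c hc => ?_) (hint.const_mul _) (.of_forall fun x c hc => ?_)).2
    · exact (u.continuous.comp (continuous_const_smul c)).aestronglyMeasurable.mul
        (hp.aestronglyMeasurable z)
    · simpa [F] using hp.integrable hz hu
    · exact ((((euler u).continuous.comp (continuous_const_smul (1 : ℝ))).const_smul
        (((1 : ℝ)⁻¹ : ℝ) : ℂ)).aestronglyMeasurable).mul (hp.aestronglyMeasurable z)
    · obtain ⟨h1, h2⟩ := hball c hc
      have hc0 : 0 < c := by linarith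
      simp only [F', norm_mul, Complex.norm_real, norm_inv, Real.norm_of_nonneg hc0.le]
      have h3 : c⁻¹ ≤ 2 := by
        rw [inv_le_comm₀ hc0 (by norm_num)]; linarith
      have h4 : ‖euler u (c • x)‖ ≤ C' * (B * radialWeight m l ‖x‖) := by
        refine (huC _).trans ?_
        rw [norm_smul, Real.norm_of_nonneg hc0.le]
        gcongr
        exact radialWeight_mul_le m l (by norm_num) h1 h2 (norm_nonneg _)
      calc _ ≤ 2 * (C' * (B * radialWeight m l ‖x‖)) * (C * ‖x‖ ^ z.re) := by
            gcongr
            · exact mul_nonneg zero_le_two ((norm_nonneg _).trans h4)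
            · exact hpC z x
        _ = _ := by ring
    · obtain ⟨h1, h2⟩ := hball c hc
      have hc0 : c ≠ 0 := by linarith
      have h5 : HasDerivAt (fun c : ℝ => u (c • x)) (fderiv ℝ u (c • x) x) c := by
        refine (u.hasFDerivAt (c • x)).comp_hasDerivAt c ?_
        simpa using (hasDerivAt_id c).smul_const x
      have h6 : fderiv ℝ u (c • x) x = ((c⁻¹ : ℝ) : ℂ) * euler u (c • x) := by
        rw [euler_apply, map_smul, Complex.real_smul, ← mul_assoc, ← Complex.ofReal_mul,
          inv_mul_cancel₀ hc0, Complex.ofReal_one, one_mul]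
      rw [h6] at h5
      exact h5.mul_const _
  have hscale : ∀ c : ℝ, 0 < c → ∫ x, F c x = (c : ℂ) ^ (-(N : ℂ) - z) * ∫ x, F 1 x := by
    intro c hc
    have h1 := Measure.integral_comp_smul (volume : Measure (EuclideanSpace ℝ (Fin N)))
      (fun x => u x * homogeneousExtension p z x) c
    rw [finrank_euclideanSpace_fin, abs_of_pos (by positivity)] at h1
    simp only [homogeneousExtension_smul p z hc] at h1
    have h2 : ∀ x, u (c • x) * ((c : ℂ) ^ z * homogeneousExtension p z x) = (c : ℂ) ^ z * F c x :=
      fun x => by simp only [F]; ring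
    simp only [h2] at h1
    rw [integral_const_mul, Complex.real_smul] at h1
    have hc' : (c : ℂ) ≠ 0 := by exact_mod_cast hc.ne'
    have hcz : (c : ℂ) ^ z ≠ 0 := by simp [Complex.cpow_eq_zero_iff, hc']
    rw [← mul_right_inj' hcz, h1, ← mul_assoc, ← Complex.cpow_add _ _ hc', add_sub_cancel,
      Complex.cpow_neg, Complex.cpow_natCast]
    simp [F]
  have h7 : HasDerivAt (fun c : ℝ => (c : ℂ) ^ (-(N : ℂ) - z) * ∫ x, F 1 x)
      ((-(N : ℂ) - z) * ∫ x, F 1 x) 1 := by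
    have h4 : HasDerivAt (fun c : ℂ => c ^ (-(N : ℂ) - z)) (-(N : ℂ) - z) ((1 : ℝ) : ℂ) := by
      have := (hasDerivAt_id (1 : ℂ)).cpow_const (c := -(N : ℂ) - z) (by simp)
      simpa using this
    exact h4.comp_ofReal.mul_const _
  have h8 := key.unique (h7.congr_of_eventuallyEq (by
    filter_upwards [lt_mem_nhds (show (0 : ℝ) < 1 by norm_num)] with c hc using hscale c hc))
  simpa [F, F'] using h8

theorem IsEvenOffZero.integral_eulerProd_succ {p : EuclideanSpace ℝ (Fin N) → ℂ}
    (hp : IsEvenOffZero p) {m : ℕ} {z : ℂ} (hz : -(N : ℝ) - m < z.re)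
    {u : 𝓢(EuclideanSpace ℝ (Fin N), ℂ)} {k : ℕ} (hk : VanishesToOrder m (eulerProd k u)) :
    ∫ x, eulerProd (k + 1) u x * homogeneousExtension p z x =
      (-(N : ℂ) - z - 2 * k) * ∫ x, eulerProd k u x * homogeneousExtension p z x := by
  rw [sub_mul, ← hp.integral_euler hz hk, ← integral_const_mul, ← integral_sub
    (hp.integrable hz hk.euler) ((hp.integrable hz hk).const_mul _)]
  refine integral_congr_ae (.of_forall fun x => ?_)
  simp only [eulerProd_succ, sub_apply, smul_apply, Complex.real_smul]
  push_cast
  ring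

/-- The pairing with a homogeneous function depends holomorphically on the degree. -/
theorem IsEvenOffZero.differentiableAt_integral {p : EuclideanSpace ℝ (Fin N) → ℂ}
    (hp : IsEvenOffZero p) {m : ℕ} {z₀ : ℂ} (hz : -(N : ℝ) - m < z₀.re)
    {u : 𝓢(EuclideanSpace ℝ (Fin N), ℂ)} (hu : VanishesToOrder m u) :
    DifferentiableAt ℂ (fun z => ∫ x, u x * homogeneousExtension p z x) z₀ := by
  obtain ⟨R, hR, hR'⟩ : ∃ R : ℝ, 0 < R ∧ -(N : ℝ) - m < z₀.re - R :=
    ⟨(z₀.re - (-(N : ℝ) - m)) / 2, by linarith, by linarith⟩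
  obtain ⟨l, hl⟩ := exists_nat_gt (z₀.re + R + N)
  obtain ⟨C, hC, hpC⟩ := hp.exists_norm_le
  obtain ⟨C', hC', huC⟩ := hu.exists_norm_le l
  have hint1 := integrable_norm_rpow_mul_radialWeight_euclidean (N := N) (m := m) (l := l)
    (a := z₀.re - R) hR' (by linarith)
  have hint2 := integrable_norm_rpow_mul_radialWeight_euclidean (N := N) (m := m) (l := l)
    (a := z₀.re + R) (by linarith) hl
  set b : EuclideanSpace ℝ (Fin N) → ℝ := fun x => C' * C *
    (‖x‖ ^ (z₀.re - R) * radialWeight m l ‖x‖ + ‖x‖ ^ (z₀.re + R) * radialWeight m l ‖x‖)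
  have hb : Integrable b := (hint1.add hint2).const_mul _
  have hbound : ∀ x, x ≠ 0 → ∀ z ∈ Metric.closedBall z₀ R,
      ‖u x * homogeneousExtension p z x‖ ≤ b x := by
    intro x hx z hzR
    have hx' : 0 < ‖x‖ := norm_pos_iff.2 hx
    have h1 : |(z - z₀).re| ≤ R := (Complex.abs_re_le_norm _).trans (mem_closedBall_iff_norm.1 hzR)
    rw [Complex.sub_re, abs_le] at h1
    have h2 := rpow_le_rpow_add_rpow (a := z₀.re - R) (b := z.re) (c := z₀.re + R) hx'
      (by linarith) (by linarith)
    have h3 := radialWeight_nonneg m l hx'.le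
    rw [norm_mul]
    calc _ ≤ (C' * radialWeight m l ‖x‖) *
          (C * (‖x‖ ^ (z₀.re - R) + ‖x‖ ^ (z₀.re + R))) := by
          gcongr
          · exact huC x
          · exact (hpC z x).trans (by gcongr)
      _ = _ := by simp only [b]; ring
  have hderiv : ∀ x : EuclideanSpace ℝ (Fin N), x ≠ 0 → ∀ z : ℂ,
      HasDerivAt (fun z => u x * homogeneousExtension p z x)
        (Complex.log ‖x‖ * (u x * homogeneousExtension p z x)) z := by
    intro x hx z
    have hx' : (‖x‖ : ℂ) ≠ 0 := by exact_mod_cast norm_ne_zero_iff.2 hx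
    have h1 : HasDerivAt (fun z : ℂ => (‖x‖ : ℂ) ^ z) _ z :=
      (hasDerivAt_id z).const_cpow (Or.inl hx')
    have h2 := (h1.mul_const (p (‖x‖⁻¹ • x))).const_mul (u x)
    have e : u x * ((‖x‖ : ℂ) ^ id z * Complex.log ‖x‖ * 1 * p (‖x‖⁻¹ • x)) =
        Complex.log ‖x‖ * (u x * homogeneousExtension p z x) := by
      simp only [homogeneousExtension, id]
      ring
    rw [e] at h2
    exact h2
  have hne : ∀ᵐ x : EuclideanSpace ℝ (Fin N), x ≠ 0 := by
    simp [ae_iff]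
  have hm : ∀ z, AEStronglyMeasurable (fun x => u x * homogeneousExtension p z x) volume :=
    fun z => u.continuous.aestronglyMeasurable.mul (hp.aestronglyMeasurable z)
  refine (hasDerivAt_integral_of_dominated_loc_of_deriv_le (s := Metric.ball z₀ (R / 2))
    (F' := fun z x => Complex.log ‖x‖ * (u x * homogeneousExtension p z x))
    (bound := fun x => b x / (R / 2)) (Metric.ball_mem_nhds _ (by positivity))
    (.of_forall hm) (hp.integrable hz hu) ?_ ?_ (hb.div_const _) ?_).2.differentiableAt
  · refine AEStronglyMeasurable.mul ?_ (hm z₀)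
    exact (Complex.measurable_log.comp
      (Complex.measurable_ofReal.comp measurable_norm)).aestronglyMeasurable
  · filter_upwards [hne] with x hx z hzR
    rw [← (hderiv x hx z).deriv]
    -- Cauchy's estimate on the circle of radius `R / 2` about `z`.
    refine Complex.norm_deriv_le_of_forall_mem_sphere_norm_le (half_pos hR) ?_ fun w hw => ?_
    · exact Differentiable.diffContOnCl fun w => (hderiv x hx w).differentiableAt
    · refine hbound x hx w ?_
      rw [mem_closedBall_iff_norm]
      rw [mem_sphere_iff_norm] at hw
      rw [mem_ball_iff_norm] at hzR
      calc ‖w - z₀‖ = ‖(w - z) + (z - z₀)‖ := by ring_nf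
        _ ≤ ‖w - z‖ + ‖z - z₀‖ := norm_add_le _ _
        _ ≤ R := by linarith
  · filter_upwards [hne] with x hx z _ using hderiv x hx z

end

/-! ### Meromorphic continuation of the pairing -/

namespace SchwartzMap

universe u

variable {E : Type} {F : Type u} [NormedAddCommGroup E] [NormedSpace ℝ E]
  [NormedAddCommGroup F] [NormedSpace ℝ F]

/-- The reflection `u ↦ (x ↦ u (-x))` of Schwartz functions. -/
def reflection : 𝓢(E, F) →L[ℝ] 𝓢(E, F) :=
  compCLMOfContinuousLinearEquiv ℝ (ContinuousLinearEquiv.neg ℝ)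

theorem reflection_apply (u : 𝓢(E, F)) (x : E) : reflection u x = u (-x) := rfl

/-- The even part `u ↦ (x ↦ (u x + u (-x)) / 2)` of Schwartz functions. -/
def evenPart : 𝓢(E, F) →L[ℝ] 𝓢(E, F) :=
  (1 / 2 : ℝ) • (ContinuousLinearMap.id ℝ _ + reflection)

theorem evenPart_apply (u : 𝓢(E, F)) (x : E) : evenPart u x = (1 / 2 : ℝ) • (u x + u (-x)) := rfl

theorem evenPart_even (u : 𝓢(E, F)) (x : E) : evenPart u (-x) = evenPart u x := by
  rw [evenPart_apply, evenPart_apply, neg_neg, add_comm]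

theorem evenPart_reflection (u : 𝓢(E, F)) : evenPart (reflection u) = evenPart u := by
  ext x
  rw [evenPart_apply, evenPart_apply, reflection_apply, reflection_apply, neg_neg, add_comm]

end SchwartzMap

section

variable {N : ℕ}

/-- The factor by which `∏ j < k, (euler - 2 * j)` acts on homogeneous distributions of
degree `z`. -/
def eulerFactor (N k : ℕ) (z : ℂ) : ℂ := ∏ j ∈ Finset.range k, (-(N : ℂ) - z - 2 * j)

theorem eulerFactor_ne_zero {k : ℕ} {z : ℂ} (hz : ∀ j : ℕ, z ≠ -(N : ℂ) - 2 * j) :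
    eulerFactor N k z ≠ 0 := by
  refine Finset.prod_ne_zero_iff.2 fun j _ h => hz j ?_
  linear_combination -h

theorem differentiable_eulerFactor (N k : ℕ) : Differentiable ℂ (eulerFactor N k) := by
  unfold eulerFactor
  fun_prop

/-- The pairing of a Schwartz function with the homogeneous extension of degree `z` of `p`, as
continued to `-N - 2 * k < Re z` by means of the Euler operator. Only the even part of the test
function is paired: the odd part contributes nothing, and would not vanish to order `2 * k`. -/
def regularizedPairing (k : ℕ) (p : EuclideanSpace ℝ (Fin N) → ℂ) (z : ℂ)
    (u : 𝓢(EuclideanSpace ℝ (Fin N), ℂ)) : ℂ :=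
  (eulerFactor N k z)⁻¹ * ∫ x, eulerProd k (evenPart u) x * homogeneousExtension p z x

/-- The meromorphic continuation in `z` of the pairing of a Schwartz function with the homogeneous
extension of degree `z` of `p`; at the poles `z = -N - 2 * j` its value is `0`. -/
def homogeneousPairing (p : EuclideanSpace ℝ (Fin N) → ℂ) (z : ℂ)
    (u : 𝓢(EuclideanSpace ℝ (Fin N), ℂ)) : ℂ :=
  regularizedPairing ⌈‖z‖⌉₊ p z u

variable [NeZero N]

omit [NeZero N] in
theorem vanishesToOrder_eulerProd_evenPart (k : ℕ) (u : 𝓢(EuclideanSpace ℝ (Fin N), ℂ)) :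
    VanishesToOrder (2 * k) (eulerProd k (evenPart u)) :=
  vanishesToOrder_eulerProd k (evenPart_even u)

theorem neg_lt_re_of_norm_le {z : ℂ} {k : ℕ} (hk : ‖z‖ ≤ k) :
    -(N : ℝ) - (2 * k : ℕ) < z.re := by
  have h1 := (abs_le.1 (Complex.abs_re_le_norm z)).1
  have h2 : (0 : ℝ) < N := by exact_mod_cast Nat.pos_of_ne_zero (NeZero.ne N)
  have h3 := norm_nonneg z
  push_cast
  linarith

variable {p : EuclideanSpace ℝ (Fin N) → ℂ}

/-- By Euler's identity the continuations for different `k` agree where both are defined. -/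
theorem IsEvenOffZero.regularizedPairing_succ (hp : IsEvenOffZero p) {k : ℕ} {z : ℂ}
    (hz : -(N : ℝ) - (2 * k : ℕ) < z.re) (u : 𝓢(EuclideanSpace ℝ (Fin N), ℂ)) :
    regularizedPairing (k + 1) p z u = regularizedPairing k p z u := by
  have h0 : -(N : ℂ) - z - 2 * k ≠ 0 := by
    intro h
    have := congrArg Complex.re h
    simp at this
    push_cast at hz
    linarith
  rw [regularizedPairing, regularizedPairing,
    hp.integral_eulerProd_succ hz (vanishesToOrder_eulerProd_evenPart k u), eulerFactor,
    Finset.prod_range_succ, ← eulerFactor, mul_inv, mul_assoc, inv_mul_cancel_left₀ h0]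

theorem IsEvenOffZero.regularizedPairing_eq (hp : IsEvenOffZero p) {k n : ℕ} {z : ℂ}
    (hz : -(N : ℝ) - (2 * k : ℕ) < z.re) (hkn : k ≤ n) (u : 𝓢(EuclideanSpace ℝ (Fin N), ℂ)) :
    regularizedPairing n p z u = regularizedPairing k p z u := by
  induction n, hkn using Nat.le_induction with
  | base => rfl
  | succ n hn ih =>
    rw [hp.regularizedPairing_succ ?_, ih]
    refine lt_of_le_of_lt ?_ hz
    gcongr

theorem IsEvenOffZero.homogeneousPairing_eq (hp : IsEvenOffZero p) {k : ℕ} {z : ℂ}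
    (hk : ‖z‖ ≤ k) (u : 𝓢(EuclideanSpace ℝ (Fin N), ℂ)) :
    homogeneousPairing p z u = regularizedPairing k p z u :=
  (hp.regularizedPairing_eq (neg_lt_re_of_norm_le (Nat.le_ceil _)) (Nat.ceil_le.2 hk) u).symm

theorem IsEvenOffZero.integral_evenPart (hp : IsEvenOffZero p) {m : ℕ} {z : ℂ}
    (hz : -(N : ℝ) - m < z.re) {u : 𝓢(EuclideanSpace ℝ (Fin N), ℂ)} (hu : VanishesToOrder m u) :
    ∫ x, evenPart u x * homogeneousExtension p z x = ∫ x, u x * homogeneousExtension p z x := by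
  have h1 := hp.integrable hz hu
  have h2 := integral_neg_eq_self (fun x => u x * homogeneousExtension p z x) volume
  have h3 := h1.comp_neg
  simp only [hp.homogeneousExtension_neg] at h2 h3
  have h4 : ∀ x, evenPart u x * homogeneousExtension p z x =
      (1 / 2 : ℂ) * (u x * homogeneousExtension p z x + u (-x) * homogeneousExtension p z x) := by
    intro x
    rw [evenPart_apply, Complex.real_smul]
    push_cast
    ring
  simp only [h4]
  rw [integral_const_mul, integral_add h1 h3, h2]
  ring

/-- Away from its poles, the continued pairing agrees with the integral whenever the latter
converges because the test function vanishes at the origin to sufficient order. -/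
theorem IsEvenOffZero.homogeneousPairing_eq_integral (hp : IsEvenOffZero p) {m : ℕ} {z : ℂ}
    (hz : -(N : ℝ) - m < z.re) (hz' : ∀ j : ℕ, z ≠ -(N : ℂ) - 2 * j)
    {u : 𝓢(EuclideanSpace ℝ (Fin N), ℂ)} (hu : VanishesToOrder m u)
    (hu' : VanishesToOrder m (evenPart u)) :
    homogeneousPairing p z u = ∫ x, u x * homogeneousExtension p z x := by
  have key : ∀ k, ∫ x, eulerProd k (evenPart u) x * homogeneousExtension p z x =
      eulerFactor N k z * ∫ x, u x * homogeneousExtension p z x := by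
    intro k
    induction k with
    | zero => simp [eulerProd_zero, eulerFactor, hp.integral_evenPart hz hu]
    | succ k ih =>
      rw [hp.integral_eulerProd_succ hz (hu'.eulerProd k), ih, eulerFactor, eulerFactor,
        Finset.prod_range_succ]
      ring
  rw [homogeneousPairing, regularizedPairing, key, inv_mul_cancel_left₀ (eulerFactor_ne_zero hz')]

theorem IsEvenOffZero.homogeneousPairing_eq_integral_of_lt_re (hp : IsEvenOffZero p) {z : ℂ}
    (hz : -(N : ℝ) < z.re) (u : 𝓢(EuclideanSpace ℝ (Fin N), ℂ)) :
    homogeneousPairing p z u = ∫ x, u x * homogeneousExtension p z x := by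
  refine hp.homogeneousPairing_eq_integral (m := 0) (by simpa using hz) (fun j h => ?_)
    (vanishesToOrder_zero _) (vanishesToOrder_zero _)
  have h1 := congrArg Complex.re h
  simp at h1
  have h2 : (0 : ℝ) ≤ j := Nat.cast_nonneg j
  linarith

/-- Near each point the number of factors `⌈‖z‖⌉₊` in the definition of the pairing can be replaced
by a constant. -/
theorem IsEvenOffZero.exists_regularizedPairing_eventuallyEq (hp : IsEvenOffZero p) (z₀ : ℂ)
    (u : 𝓢(EuclideanSpace ℝ (Fin N), ℂ)) : ∃ k : ℕ,
      (fun z => homogeneousPairing p z u) =ᶠ[𝓝 z₀] (fun z => regularizedPairing k p z u) ∧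
      AnalyticAt ℂ (fun z => ∫ x, eulerProd k (evenPart u) x * homogeneousExtension p z x) z₀ := by
  have hk : ∀ z ∈ Metric.ball z₀ 1, ‖z‖ ≤ (⌈‖z₀‖⌉₊ + 1 : ℕ) := by
    intro z hz
    rw [mem_ball_iff_norm] at hz
    have h1 := norm_sub_norm_le z z₀
    have h2 := Nat.le_ceil ‖z₀‖
    push_cast
    linarith
  refine ⟨⌈‖z₀‖⌉₊ + 1, ?_, ?_⟩
  · filter_upwards [Metric.ball_mem_nhds z₀ one_pos] with z hz
      using hp.homogeneousPairing_eq (hk z hz) u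
  · refine DifferentiableOn.analyticAt (s := Metric.ball z₀ 1) (fun z hz => ?_)
      (Metric.ball_mem_nhds z₀ one_pos)
    exact (hp.differentiableAt_integral (neg_lt_re_of_norm_le (hk z hz))
      (vanishesToOrder_eulerProd_evenPart _ u)).differentiableWithinAt

theorem IsEvenOffZero.meromorphicAt_homogeneousPairing (hp : IsEvenOffZero p) (z₀ : ℂ)
    (u : 𝓢(EuclideanSpace ℝ (Fin N), ℂ)) :
    MeromorphicAt (fun z => homogeneousPairing p z u) z₀ := by
  obtain ⟨k, h1, h2⟩ := hp.exists_regularizedPairing_eventuallyEq z₀ u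
  have h3 : MeromorphicAt (fun z => regularizedPairing k p z u) z₀ :=
    ((differentiable_eulerFactor N k).analyticAt z₀).meromorphicAt.inv.mul h2.meromorphicAt
  exact h3.congr (h1.symm.filter_mono nhdsWithin_le_nhds)

theorem IsEvenOffZero.analyticAt_homogeneousPairing (hp : IsEvenOffZero p) {z₀ : ℂ}
    (hz : ∀ j : ℕ, z₀ ≠ -(N : ℂ) - 2 * j) (u : 𝓢(EuclideanSpace ℝ (Fin N), ℂ)) :
    AnalyticAt ℂ (fun z => homogeneousPairing p z u) z₀ := by
  obtain ⟨k, h1, h2⟩ := hp.exists_regularizedPairing_eventuallyEq z₀ u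
  have h3 : AnalyticAt ℂ (fun z => regularizedPairing k p z u) z₀ :=
    (((differentiable_eulerFactor N k).analyticAt z₀).inv (eulerFactor_ne_zero hz)).mul h2
  exact h3.congr h1.symm

omit [NeZero N] in
theorem eulerProd_evenPart_smul (k : ℕ) (c : ℂ) (u : 𝓢(EuclideanSpace ℝ (Fin N), ℂ)) :
    eulerProd k (evenPart (c • u)) = c • eulerProd k (evenPart u) := by
  induction k with
  | zero =>
    ext x
    simp only [eulerProd_zero, evenPart_apply, smul_apply, smul_eq_mul, Complex.real_smul]
    ring
  | succ k ih =>
    have h : ∀ v : 𝓢(EuclideanSpace ℝ (Fin N), ℂ), euler (c • v) = c • euler v := by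
      intro v
      ext x
      have : fderiv ℝ (⇑(c • v)) x = c • fderiv ℝ v x := fderiv_const_smul v.differentiableAt c
      rw [euler_apply, this]
      rfl
    rw [eulerProd_succ, eulerProd_succ, ih, h, smul_sub, smul_comm]

theorem IsEvenOffZero.homogeneousPairing_add (hp : IsEvenOffZero p) (z : ℂ)
    (u v : 𝓢(EuclideanSpace ℝ (Fin N), ℂ)) :
    homogeneousPairing p z (u + v) = homogeneousPairing p z u + homogeneousPairing p z v := by
  have hz := neg_lt_re_of_norm_le (N := N) (Nat.le_ceil ‖z‖)
  rw [homogeneousPairing, homogeneousPairing, homogeneousPairing, regularizedPairing,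
    regularizedPairing, regularizedPairing, ← mul_add, ← integral_add
    (hp.integrable hz (vanishesToOrder_eulerProd_evenPart _ u))
    (hp.integrable hz (vanishesToOrder_eulerProd_evenPart _ v))]
  simp only [map_add, add_apply, add_mul]

theorem IsEvenOffZero.continuous_homogeneousPairing (hp : IsEvenOffZero p) (z : ℂ) :
    Continuous (homogeneousPairing p z) := by
  set k := ⌈‖z‖⌉₊
  obtain ⟨l, K, hK, h⟩ := hp.exists_bound (neg_lt_re_of_norm_le (N := N) (Nat.le_ceil ‖z‖))
  set A : 𝓢(EuclideanSpace ℝ (Fin N), ℂ) → 𝓢(EuclideanSpace ℝ (Fin N), ℂ) :=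
    fun u => eulerProd k (evenPart u)
  have hA : Continuous A := (eulerProd k).continuous.comp evenPart.continuous
  have hA0 : A 0 = 0 := by simp [A]
  have hs : ∀ i j, Continuous fun u => SchwartzMap.seminorm ℝ i j (A u) := fun i j =>
    ((schwartz_withSeminorms ℝ (EuclideanSpace ℝ (Fin N)) ℂ).continuous_seminorm (i, j)).comp hA
  have h0 : homogeneousPairing p z 0 = 0 := by
    have := hp.homogeneousPairing_add z 0 0
    simpa using this
  set b : 𝓢(EuclideanSpace ℝ (Fin N), ℂ) → ℝ := fun u => ‖(eulerFactor N k z)⁻¹‖ *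
    (K * (SchwartzMap.seminorm ℝ 0 (2 * k) (A u) + SchwartzMap.seminorm ℝ (2 * k + l) 0 (A u)))
  have hb : Continuous b := continuous_const.mul (continuous_const.mul ((hs _ _).add (hs _ _)))
  have hb0 : b 0 = 0 := by simp [b, hA0]
  refine continuous_of_continuousAt_zero
    ({ toFun := homogeneousPairing p z, map_zero' := h0,
       map_add' := hp.homogeneousPairing_add z } :
      𝓢(EuclideanSpace ℝ (Fin N), ℂ) →+ ℂ) ?_
  change Tendsto (homogeneousPairing p z) (𝓝 0) (𝓝 (homogeneousPairing p z 0))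
  rw [h0]
  refine squeeze_zero_norm (a := b) (fun u => ?_) (by simpa [hb0] using hb.tendsto 0)
  rw [homogeneousPairing, regularizedPairing, norm_mul]
  exact mul_le_mul_of_nonneg_left (h _ (vanishesToOrder_eulerProd_evenPart k u)).2 (norm_nonneg _)

/-- The tempered distribution attached to `p` and the degree `z`. At the poles of the pairing it is
`0`. -/
def IsEvenOffZero.distribution (hp : IsEvenOffZero p) (z : ℂ) :
    𝓢'(EuclideanSpace ℝ (Fin N), ℂ) :=
  ContinuousLinearMap.toPointwiseConvergenceCLM _ _ _ _
    { toFun := homogeneousPairing p z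
      map_add' := hp.homogeneousPairing_add z
      map_smul' := fun c u => by
        rw [homogeneousPairing, homogeneousPairing, regularizedPairing, regularizedPairing,
          eulerProd_evenPart_smul, RingHom.id_apply, smul_eq_mul, mul_left_comm]
        simp only [smul_apply, smul_eq_mul, mul_assoc, integral_const_mul]
      cont := hp.continuous_homogeneousPairing z }

theorem IsEvenOffZero.distribution_apply (hp : IsEvenOffZero p) (z : ℂ)
    (u : 𝓢(EuclideanSpace ℝ (Fin N), ℂ)) : hp.distribution z u = homogeneousPairing p z u := rfl

theorem IsEvenOffZero.isHomogeneousDistribution (hp : IsEvenOffZero p) {z : ℂ}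
    (hz : ∀ j : ℕ, z ≠ -(N : ℂ) - 2 * j) : IsHomogeneousDistribution p z (hp.distribution z) :=
  fun u => ⟨fun z => homogeneousPairing p z u,
    fun z => hp.meromorphicAt_homogeneousPairing z u,
    fun _ hz => hp.homogeneousPairing_eq_integral_of_lt_re hz u,
    hp.analyticAt_homogeneousPairing hz u, rfl⟩

end

/-- The identity theorem for two meromorphic functions that agree on a half plane. -/
theorem eq_of_meromorphicAt_of_eq_halfPlane {F G : ℂ → ℂ} {s : ℂ} {a : ℝ}
    (hF : ∀ z, MeromorphicAt F z)
    (hG : ∀ z, MeromorphicAt G z) (h : ∀ z : ℂ, a < z.re → F z = G z) (hFs : AnalyticAt ℂ F s)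
    (hGs : AnalyticAt ℂ G s) : F s = G s := by
  have hm : MeromorphicOn (F - G) univ := fun z _ => (hF z).sub (hG z)
  have h1 : meromorphicOrderAt (F - G) ((a + 1 : ℝ) : ℂ) = ⊤ := by
    rw [meromorphicOrderAt_eq_top_iff]
    refine Filter.Eventually.filter_mono nhdsWithin_le_nhds ?_
    have : {z : ℂ | a < z.re} ∈ 𝓝 ((a + 1 : ℝ) : ℂ) :=
      (isOpen_lt continuous_const Complex.continuous_re).mem_nhds (by simp)
    filter_upwards [this] with z hz
    simp [h z hz]
  have h2 : meromorphicOrderAt (F - G) s = ⊤ := by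
    by_contra h3
    exact hm.meromorphicOrderAt_ne_top_of_isPreconnected isPreconnected_univ
      (mem_univ s) (mem_univ _) h3 h1
  rw [meromorphicOrderAt_eq_top_iff] at h2
  have h4 := (hFs.sub hGs).continuousAt.eventuallyEq_nhds_iff_eventuallyEq_nhdsNE
    (g := 0) continuousAt_const
  have h5 := (h4.1 h2).eq_of_nhds
  exact sub_eq_zero.1 h5

/-! ### The canonical embedding -/

section

variable {N : ℕ} {ν : ℂ}

theorem isEvenOffZero_of_mem {f : EuclideanSpace ℝ (Fin N) → ℂ}
    (hf : f ∈ homogeneousFunctions N ν) : IsEvenOffZero f where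
  zero := hf.1
  continuousOn := hf.2.1.continuousOn
  even x := by
    rcases eq_or_ne x 0 with rfl | hx
    · simp
    · simpa using hf.2.2 (-1) (by norm_num) x hx

theorem homogeneousExtension_of_mem {f : EuclideanSpace ℝ (Fin N) → ℂ}
    (hf : f ∈ homogeneousFunctions N ν) :
    homogeneousExtension f (-ν - (N : ℂ) / 2) = f := by
  funext x
  rcases eq_or_ne x 0 with rfl | hx
  · simp [homogeneousExtension, hf.1]
  · have hx' : ‖x‖ ≠ 0 := norm_ne_zero_iff.2 hx
    have h := hf.2.2 ‖x‖ hx' (‖x‖⁻¹ • x) (by simpa using hx)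
    rw [smul_smul, mul_inv_cancel₀ hx', one_smul, abs_norm] at h
    exact h.symm

theorem homogeneousExtension_add (f g : EuclideanSpace ℝ (Fin N) → ℂ) (z : ℂ) :
    homogeneousExtension (f + g) z = homogeneousExtension f z + homogeneousExtension g z := by
  funext x
  simp [homogeneousExtension, mul_add]

theorem homogeneousExtension_const_smul (c : ℂ) (f : EuclideanSpace ℝ (Fin N) → ℂ) (z : ℂ) :
    homogeneousExtension (c • f) z = c • homogeneousExtension f z := by
  funext x
  simp [homogeneousExtension, mul_left_comm]

variable [NeZero N]

variable (N ν) in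
/-- The embedding of the homogeneous functions of degree `-ν - N / 2` into the tempered
distributions by meromorphic continuation. -/
def homogeneousEmbedding :
    homogeneousFunctions N ν →ₗ[ℂ] 𝓢'(EuclideanSpace ℝ (Fin N), ℂ) where
  toFun f := (isEvenOffZero_of_mem f.2).distribution (-ν - (N : ℂ) / 2)
  map_add' f g := by
    ext u
    have hz := neg_lt_re_of_norm_le (N := N) (Nat.le_ceil ‖-ν - (N : ℂ) / 2‖)
    have hu := vanishesToOrder_eulerProd_evenPart ⌈‖-ν - (N : ℂ) / 2‖⌉₊ u
    rw [add_apply]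
    simp only [IsEvenOffZero.distribution_apply, homogeneousPairing, regularizedPairing]
    rw [← mul_add, ← integral_add ((isEvenOffZero_of_mem f.2).integrable hz hu)
      ((isEvenOffZero_of_mem g.2).integrable hz hu), Submodule.coe_add, homogeneousExtension_add]
    simp only [Pi.add_apply, mul_add]
  map_smul' c f := by
    ext u
    rw [RingHom.id_apply, smul_apply]
    simp only [IsEvenOffZero.distribution_apply, homogeneousPairing, regularizedPairing]
    rw [Submodule.coe_smul, homogeneousExtension_const_smul]
    simp only [Pi.smul_apply, smul_eq_mul, mul_left_comm _ c, integral_const_mul]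

theorem homogeneousEmbedding_apply (f : homogeneousFunctions N ν)
    (u : 𝓢(EuclideanSpace ℝ (Fin N), ℂ)) :
    homogeneousEmbedding N ν f u = homogeneousPairing f (-ν - (N : ℂ) / 2) u := rfl

/-- A homogeneous function is determined by its distribution, which away from the origin is given
by integration. -/
theorem injective_homogeneousEmbedding (hν : ∀ j : ℕ, -ν - (N : ℂ) / 2 ≠ -(N : ℂ) - 2 * j) :
    Function.Injective (homogeneousEmbedding N ν) := by
  refine (injective_iff_map_eq_zero _).2 fun f hf => ?_
  have hp := isEvenOffZero_of_mem f.2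
  obtain ⟨m, hm⟩ := exists_nat_gt (-(N : ℝ) - (-ν - (N : ℂ) / 2).re)
  have hae : ∀ᵐ x : EuclideanSpace ℝ (Fin N), x ∈ ({0}ᶜ : Set (EuclideanSpace ℝ (Fin N))) →
      f.1 x = 0 := by
    refine isOpen_compl_singleton.ae_eq_zero_of_integral_contDiff_smul_eq_zero
      (hp.continuousOn.locallyIntegrableOn isOpen_compl_singleton.measurableSet) ?_
    intro g hg hgc hgs
    have hc : HasCompactSupport fun x => (g x : ℂ) := hgc.comp_left Complex.ofReal_zero
    set u : 𝓢(EuclideanSpace ℝ (Fin N), ℂ) :=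
      hc.toSchwartzMap (Complex.ofRealCLM.contDiff.comp hg) with hu
    have hu_apply : ∀ x, u x = g x := fun x => rfl
    have h0 : ∀ᶠ x in 𝓝 0, u x = 0 := by
      have h1 : (tsupport g)ᶜ ∈ 𝓝 (0 : EuclideanSpace ℝ (Fin N)) :=
        (isClosed_tsupport g).isOpen_compl.mem_nhds fun h => hgs h rfl
      filter_upwards [h1] with x hx
      rw [hu_apply, image_eq_zero_of_notMem_tsupport hx, Complex.ofReal_zero]
    have h0' : ∀ᶠ x in 𝓝 0, evenPart u x = 0 := by
      have h1 : ∀ᶠ x : EuclideanSpace ℝ (Fin N) in 𝓝 0, u (-x) = 0 := by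
        have : Tendsto (fun x : EuclideanSpace ℝ (Fin N) => -x) (𝓝 0) (𝓝 0) := by
          simpa using (continuous_neg.tendsto (0 : EuclideanSpace ℝ (Fin N)))
        exact this.eventually h0
      filter_upwards [h0, h1] with x hx hx'
      rw [evenPart_apply, hx, hx', add_zero, smul_zero]
    have h2 := hp.homogeneousPairing_eq_integral (m := m) (by linarith) hν
      (VanishesToOrder.of_eventuallyEq_zero h0 m) (VanishesToOrder.of_eventuallyEq_zero h0' m)
    rw [homogeneousExtension_of_mem f.2] at h2
    have h3 : homogeneousEmbedding N ν f u = 0 := by rw [hf]; rfl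
    rw [homogeneousEmbedding_apply, h2] at h3
    rw [← h3]
    rfl
  have hon : EqOn f.1 0 {0}ᶜ :=
    Measure.eqOn_open_of_ae_eq (μ := volume)
      ((ae_restrict_iff' isOpen_compl_singleton.measurableSet).2 hae)
      isOpen_compl_singleton hp.continuousOn continuousOn_const
  ext x
  rcases eq_or_ne x 0 with rfl | hx
  · exact hp.zero
  · exact hon hx

theorem isCanonicalEmbedding_homogeneousEmbedding
    (hν : ∀ j : ℕ, -ν - (N : ℂ) / 2 ≠ -(N : ℂ) - 2 * j) :
    IsCanonicalEmbedding N ν (homogeneousEmbedding N ν) := by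
  refine ⟨injective_homogeneousEmbedding hν, fun f T => ?_⟩
  have h := (isEvenOffZero_of_mem f.2).isHomogeneousDistribution hν
  constructor
  · intro hT
    ext u
    obtain ⟨F, hF1, hF2, hF3, hF4⟩ := hT u
    obtain ⟨G, hG1, hG2, hG3, hG4⟩ := h u
    rw [← hF4]
    refine Eq.trans ?_ hG4
    exact eq_of_meromorphicAt_of_eq_halfPlane hF1 hG1
      (fun z hz => (hF2 z hz).trans (hG2 z hz).symm) hF3 hG3
  · rintro rfl
    exact h

end

/-! ### The Euler operator and the Fourier transform -/

section

variable {N : ℕ}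

/-- The dilation `u ↦ (x ↦ u (c x))` of Schwartz functions. -/
def dilation (c : ℝˣ) : 𝓢(EuclideanSpace ℝ (Fin N), ℂ) →L[ℝ] 𝓢(EuclideanSpace ℝ (Fin N), ℂ) :=
  compCLMOfContinuousLinearEquiv ℝ (ContinuousLinearEquiv.smulLeft c)

theorem dilation_apply (c : ℝˣ) (u : 𝓢(EuclideanSpace ℝ (Fin N), ℂ))
    (x : EuclideanSpace ℝ (Fin N)) : dilation c u x = u ((c : ℝ) • x) := rfl

theorem euler_dilation (c : ℝˣ) (u : 𝓢(EuclideanSpace ℝ (Fin N), ℂ)) :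
    euler (dilation c u) = dilation c (euler u) := by
  ext x
  have h1 : HasFDerivAt (fun y : EuclideanSpace ℝ (Fin N) => (c : ℝ) • y)
    ((c : ℝ) • ContinuousLinearMap.id ℝ _) x := (hasFDerivAt_id x).const_smul (c : ℝ)
  have h2 : HasFDerivAt (dilation c u) _ x := (u.hasFDerivAt ((c : ℝ) • x)).comp x h1
  rw [dilation_apply, euler_apply, euler_apply, h2.fderiv]
  simp

theorem euler_pairing (u v : 𝓢(EuclideanSpace ℝ (Fin N), ℂ)) :
    euler (pairing (ContinuousLinearMap.mul ℝ ℂ) u v) =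
      pairing (ContinuousLinearMap.mul ℝ ℂ) (euler u) v +
        pairing (ContinuousLinearMap.mul ℝ ℂ) u (euler v) := by
  ext x
  have h1 : HasFDerivAt (pairing (ContinuousLinearMap.mul ℝ ℂ) u v) _ x :=
    (u.hasFDerivAt x).mul (v.hasFDerivAt x)
  rw [euler_apply, h1.fderiv]
  simp [euler_apply]
  ring

theorem integrable_mul (u v : 𝓢(EuclideanSpace ℝ (Fin N), ℂ)) :
    Integrable (fun x => u x * v x) :=
  (pairing (ContinuousLinearMap.mul ℝ ℂ) u v).integrable

/-- Euler's identity for the constant function `1`, which is homogeneous of degree `0`. -/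
theorem integral_euler [NeZero N] (u : 𝓢(EuclideanSpace ℝ (Fin N), ℂ)) :
    ∫ x, euler u x = -(N : ℂ) * ∫ x, u x := by
  -- The constant is set to `0` at the origin, to meet the convention for `IsEvenOffZero`.
  set p : EuclideanSpace ℝ (Fin N) → ℂ := indicator {0}ᶜ 1
  have hp1 : ∀ x, x ≠ 0 → p x = 1 := fun x hx => indicator_of_mem (by simpa using hx) _
  have hp : IsEvenOffZero p :=
    { zero := by simp [p]
      continuousOn := continuousOn_const.congr fun x hx => hp1 x hx
      even := fun x => by
        rcases eq_or_ne x 0 with rfl | hx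
        · simp
        · rw [hp1 x hx, hp1 _ (neg_ne_zero.2 hx)] }
  have h0 : -(N : ℝ) - (0 : ℕ) < (0 : ℂ).re := by
    have : (0 : ℝ) < N := by exact_mod_cast Nat.pos_of_ne_zero (NeZero.ne N)
    simpa using this
  have h := hp.integral_euler h0 (vanishesToOrder_zero u)
  have h1 : ∀ v : 𝓢(EuclideanSpace ℝ (Fin N), ℂ),
      ∫ x, v x * homogeneousExtension p 0 x = ∫ x, v x := by
    intro v
    refine integral_congr_ae ?_
    have hne : ∀ᵐ x : EuclideanSpace ℝ (Fin N), x ≠ 0 := by simp [ae_iff]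
    filter_upwards [hne] with x hx
    rw [homogeneousExtension, Complex.cpow_zero, hp1 _ (by simpa using hx), mul_one, mul_one]
  rw [h1, h1, sub_zero] at h
  exact h

theorem integral_euler_mul [NeZero N] (u v : 𝓢(EuclideanSpace ℝ (Fin N), ℂ)) :
    ∫ x, euler u x * v x = -(∫ x, u x * euler v x) - (N : ℂ) * ∫ x, u x * v x := by
  have h := integral_euler (pairing (ContinuousLinearMap.mul ℝ ℂ) u v)
  rw [euler_pairing] at h
  simp only [add_apply, pairing_apply_apply, ContinuousLinearMap.mul_apply'] at h
  rw [integral_add (integrable_mul _ _) (integrable_mul _ _)] at h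
  linear_combination h

open LineDeriv in
theorem euler_eq_sum (u : 𝓢(EuclideanSpace ℝ (Fin N), ℂ)) :
    euler u = ∑ i, smulLeftCLM ℂ (inner ℝ · (EuclideanSpace.basisFun (Fin N) ℝ i))
      (∂_{EuclideanSpace.basisFun (Fin N) ℝ i} u) := by
  ext x
  have hg : ∀ m : EuclideanSpace ℝ (Fin N), (inner ℝ · m).HasTemperateGrowth := fun m => by
    fun_prop
  rw [sum_apply, euler_apply]
  conv_lhs => rw [← (EuclideanSpace.basisFun (Fin N) ℝ).sum_repr' x]
  rw [map_sum]
  refine Finset.sum_congr rfl fun i _ => ?_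
  rw [smulLeftCLM_apply_apply (hg _), map_smul, lineDerivOp_apply_eq_fderiv, real_inner_comm,
    (EuclideanSpace.basisFun (Fin N) ℝ).sum_repr' x]

open LineDeriv in
/-- The Fourier transform intertwines the Euler operator with `-euler - N`. -/
theorem fourier_euler (u : 𝓢(EuclideanSpace ℝ (Fin N), ℂ)) :
    𝓕 (euler u) = -euler (𝓕 u) - (N : ℝ) • 𝓕 u := by
  set b := EuclideanSpace.basisFun (Fin N) ℝ
  have hg : ∀ m : EuclideanSpace ℝ (Fin N), (inner ℝ · m).HasTemperateGrowth := fun m => by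
    fun_prop
  have hpi : (2 * Real.pi * Complex.I : ℂ) ≠ 0 := by simp [Real.pi_ne_zero]
  have key : ∀ i, 𝓕 (smulLeftCLM ℂ (inner ℝ · (b i)) (∂_{b i} u)) =
      -∂_{b i} (smulLeftCLM ℂ (inner ℝ · (b i)) (𝓕 u)) := by
    intro i
    have h1 := lineDerivOp_fourier_eq (∂_{b i} u) (b i)
    rw [fourier_lineDerivOp_eq, FourierTransform.fourier_smul, lineDerivOp_smul, neg_smul,
      ← smul_neg] at h1
    have h2 := smul_right_injective _ hpi h1
    rw [h2, neg_neg]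
  have h3 : 𝓕 (euler u) = ∑ i, 𝓕 (smulLeftCLM ℂ (inner ℝ · (b i)) (∂_{b i} u)) := by
    rw [euler_eq_sum, ← fourierTransformCLM_apply (𝕜 := ℂ), map_sum]
    rfl
  rw [h3, euler_eq_sum]
  simp only [key]
  ext x
  have h4 : ∀ i, ∂_{b i} (smulLeftCLM ℂ (inner ℝ · (b i)) (𝓕 u)) x =
      𝓕 u x + smulLeftCLM ℂ (inner ℝ · (b i)) (∂_{b i} (𝓕 u)) x := by
    intro i
    have h5 : HasFDerivAt (fun y => inner ℝ y (b i) • 𝓕 u y) _ x :=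
      ((innerSL ℝ).flip (b i)).hasFDerivAt.smul ((𝓕 u).hasFDerivAt x)
    have h6 : (smulLeftCLM ℂ (inner ℝ · (b i)) (𝓕 u) : EuclideanSpace ℝ (Fin N) → ℂ) =
        fun y => inner ℝ y (b i) • 𝓕 u y := by
      funext y
      rw [smulLeftCLM_apply_apply (hg _)]
    rw [lineDerivOp_apply_eq_fderiv, h6, h5.fderiv, smulLeftCLM_apply_apply (hg _),
      lineDerivOp_apply_eq_fderiv]
    have h7 : (inner ℝ (b i) (b i) : ℝ) = 1 := by
      rw [real_inner_self_eq_norm_sq, b.norm_eq_one, one_pow]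
    simp only [add_apply, smul_apply, ContinuousLinearMap.smulRight_apply,
      ContinuousLinearMap.flip_apply, innerSL_apply_apply, h7, one_smul]
    rw [add_comm]
  simp only [sum_apply, neg_apply, sub_apply, smul_apply, h4, Finset.sum_neg_distrib,
    Finset.sum_add_distrib, Finset.sum_const, Finset.card_univ, Fintype.card_fin,
    Complex.real_smul, nsmul_eq_mul, b]
  push_cast
  ring

theorem fourier_reflection (u : 𝓢(EuclideanSpace ℝ (Fin N), ℂ)) :
    𝓕 (reflection u) = reflection (𝓕 u) := by
  ext y
  rw [reflection_apply, fourier_coe, fourier_coe, Real.fourier_eq, Real.fourier_eq,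
    ← integral_neg_eq_self]
  simp [reflection_apply]

theorem fourier_evenPart (u : 𝓢(EuclideanSpace ℝ (Fin N), ℂ)) :
    𝓕 (evenPart u) = evenPart (𝓕 u) := by
  have h : ∀ v : 𝓢(EuclideanSpace ℝ (Fin N), ℂ), evenPart v = (1 / 2 : ℝ) • (v + reflection v) :=
    fun v => rfl
  rw [h, h, FourierTransform.fourier_smul, FourierTransform.fourier_add, fourier_reflection]

/-- The correlation `t ↦ ∫ u (t x) v x dx` of Schwartz functions under dilation. -/
def correlation (u v : 𝓢(EuclideanSpace ℝ (Fin N), ℂ)) (t : ℝ) : ℂ := ∫ x, u (t • x) * v x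

/-- Parseval's formula for a dilated function. -/
theorem correlation_fourier (u v : 𝓢(EuclideanSpace ℝ (Fin N), ℂ)) {t : ℝ} (ht : 0 < t) :
    correlation u (𝓕 v) t = (t : ℂ) ^ (-(N : ℂ)) * correlation (𝓕 u) v t⁻¹ := by
  set c : ℝˣ := Units.mk0 t ht.ne'
  have h1 : ∀ y, 𝓕 (dilation c u) y = (t : ℂ) ^ (-(N : ℂ)) * 𝓕 u (t⁻¹ • y) := by
    intro y
    rw [fourier_coe, fourier_coe, Real.fourier_eq, Real.fourier_eq]
    have h2 := Measure.integral_comp_smul (volume : Measure (EuclideanSpace ℝ (Fin N)))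
      (fun x => Real.fourierChar (-inner ℝ x (t⁻¹ • y)) • u x) t
    rw [finrank_euclideanSpace_fin, abs_of_pos (by positivity), Complex.real_smul] at h2
    rw [Complex.cpow_neg, Complex.cpow_natCast]
    push_cast at h2
    rw [← h2]
    refine integral_congr_ae (.of_forall fun x => ?_)
    simp only [dilation_apply, c, Units.val_mk0, inner_smul_left, inner_smul_right]
    congr 3
    simp
    field_simp
  have h3 := integral_fourier_mul_eq (dilation c u) v
  simp only [h1, mul_assoc] at h3
  rw [integral_const_mul] at h3
  exact h3.symm

/-- The transpose of `euler - a` is `-euler - N - a`, and `euler` commutes with dilations. -/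
theorem correlation_adjoint [NeZero N] (u v : 𝓢(EuclideanSpace ℝ (Fin N), ℂ)) (a : ℝ) {t : ℝ}
    (ht : 0 < t) :
    correlation (euler u - a • u) v t = correlation u (-euler v - (N + a : ℝ) • v) t := by
  set c : ℝˣ := Units.mk0 t ht.ne'
  have h := integral_euler_mul (dilation c u) v
  rw [euler_dilation] at h
  have h1 : correlation (euler u - a • u) v t =
      (∫ x, dilation c (euler u) x * v x) - a * ∫ x, dilation c u x * v x := by
    rw [← integral_const_mul,
      ← integral_sub (integrable_mul _ _) ((integrable_mul _ _).const_mul _)]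
    refine integral_congr_ae (.of_forall fun x => ?_)
    simp only [sub_apply, smul_apply, dilation_apply, c, Units.val_mk0, Complex.real_smul]
    ring
  have h2 : correlation u (-euler v - (N + a : ℝ) • v) t =
      -(∫ x, dilation c u x * euler v x) - (N + a) * ∫ x, dilation c u x * v x := by
    rw [← integral_const_mul, ← integral_neg, ← integral_sub (integrable_mul _ _).fun_neg
      ((integrable_mul _ _).const_mul _)]
    refine integral_congr_ae (.of_forall fun x => ?_)
    simp only [sub_apply, smul_apply, neg_apply, dilation_apply, c, Units.val_mk0,
      Complex.real_smul]
    push_cast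
    ring
  rw [h1, h2]
  linear_combination h

theorem correlation_adjoint' [NeZero N] (u v : 𝓢(EuclideanSpace ℝ (Fin N), ℂ)) (a : ℝ) {t : ℝ}
    (ht : 0 < t) :
    correlation (-euler u - (N + a : ℝ) • u) v t = correlation u (euler v - a • v) t := by
  have h := correlation_adjoint u v (-(N + a : ℝ)) ht
  have h1 : euler u - (-(N + a : ℝ)) • u = -(-euler u - (N + a : ℝ) • u) := by module
  have h2 : -euler v - (N + -(N + a) : ℝ) • v = -(euler v - a • v) := by module
  rw [h1, h2] at h
  simpa only [correlation, neg_apply, neg_mul, mul_neg, integral_neg, neg_inj] using h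

/-- The functional equation that underlies the theorem. In both entries `∏ j < k, (euler - 2 * j)`
is turned by the Fourier transform into its transpose, and transposition undoes this. -/
theorem correlation_eulerProd_fourier [NeZero N] (k : ℕ)
    (u v : 𝓢(EuclideanSpace ℝ (Fin N), ℂ)) {t : ℝ} (ht : 0 < t) :
    correlation (eulerProd k u) (eulerProd k (𝓕 v)) t =
      (t : ℂ) ^ (-(N : ℂ)) * correlation (eulerProd k (𝓕 u)) (eulerProd k v) t⁻¹ := by
  induction k generalizing u v with
  | zero => exact correlation_fourier u v ht
  | succ k ih =>
    set a : ℝ := 2 * k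
    have hcomm : ∀ w : 𝓢(EuclideanSpace ℝ (Fin N), ℂ),
        eulerProd (k + 1) w = eulerProd k (euler w - a • w) := fun w => by
      rw [eulerProd_succ, map_sub, map_smul, eulerProd_euler]
    have hcomm' : ∀ w : 𝓢(EuclideanSpace ℝ (Fin N), ℂ),
        eulerProd k (-euler w - (N + a : ℝ) • w) =
          -euler (eulerProd k w) - (N + a : ℝ) • eulerProd k w := fun w => by
      rw [map_sub, map_neg, map_smul, eulerProd_euler]
    have hF : ∀ w : 𝓢(EuclideanSpace ℝ (Fin N), ℂ),
        𝓕 (euler w - a • w) = -euler (𝓕 w) - (N + a : ℝ) • 𝓕 w := fun w => by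
      rw [sub_eq_add_neg, ← neg_smul, FourierTransform.fourier_add, FourierTransform.fourier_smul,
        fourier_euler]
      module
    have hF' : ∀ w : 𝓢(EuclideanSpace ℝ (Fin N), ℂ),
        𝓕 (-euler w - (N + a : ℝ) • w) = euler (𝓕 w) - a • 𝓕 w := fun w => by
      rw [sub_eq_add_neg, ← neg_smul, ← neg_one_smul ℝ (euler w), FourierTransform.fourier_add,
        FourierTransform.fourier_smul, FourierTransform.fourier_smul, fourier_euler]
      module
    rw [hcomm u, hcomm (𝓕 v), ← hF', ih, hF, hcomm', hcomm', eulerProd_succ, eulerProd_succ]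
    congr 1
    have ht' : 0 < t⁻¹ := inv_pos.2 ht
    -- Both factors `-euler - N - a` are moved across by transposition.
    set U := eulerProd k (𝓕 u)
    set V := eulerProd k v
    have h1 := correlation_adjoint (-euler U - (N + a : ℝ) • U) V a ht'
    have h2 : euler (-euler U - (N + a : ℝ) • U) - a • (-euler U - (N + a : ℝ) • U) =
        -euler (euler U - a • U) - (N + a : ℝ) • (euler U - a • U) := by
      simp only [map_sub, map_neg, map_smul]
      module
    rw [← h1, h2, correlation_adjoint' _ _ a ht']

end

/-! ### The functional equation -/

section

variable {N : ℕ} [NeZero N]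

/-- Fubini's theorem for the pairing of a radial Mellin transform with a test function. -/
theorem integral_radialMellin_mul {m n : ℕ} {u v : 𝓢(EuclideanSpace ℝ (Fin N), ℂ)}
    (hu : VanishesToOrder m u) (hv : VanishesToOrder n v) {w : ℂ} (h1 : -(m : ℝ) < w.re)
    (h2 : w.re < N + n) :
    ∫ x, radialMellin w u x * v x = mellin (correlation u v) w := by
  obtain ⟨l, hl⟩ := exists_nat_gt w.re
  obtain ⟨l', hl'⟩ := exists_nat_gt (-w.re + N)
  obtain ⟨C, hC, huC⟩ := hu.exists_norm_le l
  obtain ⟨C', hC', hvC⟩ := hv.exists_norm_le l'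
  have hw := integrableOn_rpow_mul_radialWeight (m := m) (l := l) h1 hl
  set W := ∫ t in Ioi (0 : ℝ), t ^ (w.re - 1) * radialWeight m l t
  have hW : 0 ≤ W := setIntegral_nonneg measurableSet_Ioi fun t ht =>
    mul_nonneg (Real.rpow_nonneg (le_of_lt ht) _) (radialWeight_nonneg _ _ (le_of_lt ht))
  have hne : ∀ᵐ x : EuclideanSpace ℝ (Fin N), x ≠ 0 := by simp [ae_iff]
  set H : EuclideanSpace ℝ (Fin N) → ℝ → ℂ := fun x t => (t : ℂ) ^ (w - 1) * (u (t • x) * v x)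
  have hmeas : AEStronglyMeasurable (Function.uncurry H)
      (volume.prod (volume.restrict (Ioi 0))) := by
    refine Measurable.aestronglyMeasurable ?_
    have h3 : Measurable fun y : EuclideanSpace ℝ (Fin N) × ℝ => (y.2 : ℂ) ^ (w - 1) :=
      (Complex.measurable_ofReal.comp measurable_snd).pow_const _
    have h4 : Continuous fun y : EuclideanSpace ℝ (Fin N) × ℝ => u (y.2 • y.1) * v y.1 := by
      fun_prop
    exact h3.mul h4.measurable
  have hint : ∀ x, x ≠ 0 → Integrable (H x) (volume.restrict (Ioi 0)) := by
    intro x hx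
    have h3 : IntegrableOn (fun t : ℝ => (t : ℂ) ^ (w - 1) • u (t • x)) (Ioi 0) :=
      mellinConvergent_smul hu h1 hx
    have h4 := Integrable.mul_const h3 (v x)
    simpa only [smul_eq_mul, mul_assoc] using h4
  have hH : Integrable (Function.uncurry H) (volume.prod (volume.restrict (Ioi 0))) := by
    refine (integrable_prod_iff hmeas).2 ⟨?_, ?_⟩
    · filter_upwards [hne] with x hx using hint x hx
    · have hb := (integrable_norm_rpow_mul_radialWeight_euclidean (N := N) (m := n) (l := l')
        (a := -w.re)
        (by linarith) hl').const_mul (C * W * C')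
      refine hb.mono' hmeas.norm.integral_prod_right' ?_
      filter_upwards [hne] with x hx
      have hx' : 0 < ‖x‖ := norm_pos_iff.2 hx
      have hwx : IntegrableOn (fun t => t ^ (w.re - 1) * radialWeight m l (t * ‖x‖)) (Ioi 0) := by
        refine Integrable.mono' (hw.const_mul (‖x‖ ^ m * ((min 1 ‖x‖) ^ (m + l))⁻¹)) ?_ ?_
        · exact ((measurable_id.pow_const _).mul ((measurable_radialWeight m l).comp
            (measurable_id.mul_const _))).aestronglyMeasurable
        · refine (ae_restrict_iff' measurableSet_Ioi).2 (.of_forall fun t ht => ?_)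
          have ht : 0 < t := ht
          rw [Real.norm_of_nonneg (mul_nonneg (by positivity)
            (radialWeight_nonneg _ _ (by positivity))), mul_left_comm, mul_comm t]
          gcongr
          exact radialWeight_mul_le m l hx' le_rfl le_rfl ht.le
      rw [Real.norm_of_nonneg (integral_nonneg fun t => norm_nonneg _)]
      calc ∫ t in Ioi (0 : ℝ), ‖Function.uncurry H (x, t)‖
          ≤ ∫ t in Ioi (0 : ℝ), C * ‖v x‖ * (t ^ (w.re - 1) * radialWeight m l (t * ‖x‖)) := by
            refine setIntegral_mono_on (hint x hx).norm (hwx.const_mul _) measurableSet_Ioi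
              fun t ht => ?_
            have ht : 0 < t := ht
            have h5 := huC (t • x)
            rw [norm_smul, Real.norm_of_nonneg ht.le] at h5
            simp only [Function.uncurry, H, norm_mul, norm_ofReal_cpow_sub_one ht]
            calc _ ≤ t ^ (w.re - 1) * (C * radialWeight m l (t * ‖x‖) * ‖v x‖) := by gcongr
              _ = _ := by ring
        _ = C * W * ‖v x‖ * ‖x‖ ^ (-w.re) := by
            rw [integral_const_mul, integral_rpow_mul_radialWeight_mul m l _ hx']
            ring
        _ ≤ C * W * (C' * radialWeight n l' ‖x‖) * ‖x‖ ^ (-w.re) := by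
            gcongr
            exact hvC x
        _ = _ := by ring
  have hswap := integral_integral_swap hH
  calc ∫ x, radialMellin w u x * v x = ∫ x, ∫ t in Ioi (0 : ℝ), H x t := by
        refine integral_congr_ae (.of_forall fun x => ?_)
        simp only [radialMellin, mellin, H, smul_eq_mul]
        rw [← integral_mul_const]
        simp only [mul_assoc]
    _ = ∫ t in Ioi (0 : ℝ), ∫ x, H x t := hswap
    _ = _ := by
        simp only [H, mellin, correlation, integral_const_mul, smul_eq_mul]

omit [NeZero N] in
theorem fourier_even {u : 𝓢(EuclideanSpace ℝ (Fin N), ℂ)} (hu : ∀ x, u (-x) = u x)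
    (x : EuclideanSpace ℝ (Fin N)) : 𝓕 u (-x) = 𝓕 u x := by
  have : reflection u = u := by ext y; exact hu y
  rw [← reflection_apply, ← fourier_reflection, this]

/-- The functional equation between degree `-w` and degree `w - N`, in the whole strip where both
sides converge. -/
theorem integral_radialMellin_eulerProd_fourier {k : ℕ} {u v : 𝓢(EuclideanSpace ℝ (Fin N), ℂ)}
    (hu : ∀ x, u (-x) = u x) (hv : ∀ x, v (-x) = v x) {w : ℂ} (h1 : -((2 * k : ℕ) : ℝ) < w.re)
    (h2 : w.re < N + (2 * k : ℕ)) :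
    ∫ x, radialMellin w (eulerProd k u) x * eulerProd k (𝓕 v) x =
      ∫ x, radialMellin (N - w) (eulerProd k (𝓕 u)) x * eulerProd k v x := by
  rw [integral_radialMellin_mul (vanishesToOrder_eulerProd k hu)
    (vanishesToOrder_eulerProd k (fourier_even hv)) h1 h2,
    integral_radialMellin_mul (vanishesToOrder_eulerProd k (fourier_even hu))
    (vanishesToOrder_eulerProd k hv) (by simp at *; linarith) (by simp at *; linarith)]
  have h3 : mellin (correlation (eulerProd k u) (eulerProd k (𝓕 v))) w =
      mellin (fun t : ℝ => (t : ℂ) ^ (-(N : ℂ)) •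
        correlation (eulerProd k (𝓕 u)) (eulerProd k v) t⁻¹) w := by
    refine setIntegral_congr_fun measurableSet_Ioi fun t ht => ?_
    simp only [correlation_eulerProd_fourier k u v ht, smul_eq_mul]
  rw [h3, mellin_cpow_smul, mellin_comp_inv]
  congr 1
  ring

/-- The continuation of the radial Mellin transform of an even Schwartz function to
`-2 * k < Re w`, extended by zero to the origin. Since `eulerFactor N k (w - N)` is
`∏ j < k, (-w - 2 * j)`, its only poles in `w` are at `w = -2 * j`. -/
def regularizedMellin (k : ℕ) (w : ℂ) (u : 𝓢(EuclideanSpace ℝ (Fin N), ℂ)) :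
    EuclideanSpace ℝ (Fin N) → ℂ :=
  indicator {0}ᶜ fun x => (eulerFactor N k (w - N))⁻¹ * radialMellin w (eulerProd k u) x

omit [NeZero N] in
theorem regularizedMellin_mem {k : ℕ} {w ν : ℂ} {u : 𝓢(EuclideanSpace ℝ (Fin N), ℂ)}
    (hu : ∀ x, u (-x) = u x) (hw : -((2 * k : ℕ) : ℝ) < w.re) (hν : w = ν + N / 2) :
    regularizedMellin k w u ∈ homogeneousFunctions N ν := by
  refine ⟨by simp [regularizedMellin], ?_, fun t ht x hx => ?_⟩
  · exact (contDiffOn_const (c := (eulerFactor N k (w - N))⁻¹).mul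
      (contDiffOn_radialMellin (vanishesToOrder_eulerProd k hu) hw)).congr
      fun x hx => indicator_of_mem hx _
  · have hx' : x ∈ ({0}ᶜ : Set (EuclideanSpace ℝ (Fin N))) := hx
    have htx : t • x ∈ ({0}ᶜ : Set (EuclideanSpace ℝ (Fin N))) := by simp [ht, hx]
    have h1 : radialMellin w (eulerProd k u) (t • x) =
        ((|t| : ℝ) : ℂ) ^ (-w) * radialMellin w (eulerProd k u) x := by
      rw [← radialMellin_smul w _ (abs_pos.2 ht)]
      rcases abs_choice t with h | h
      · rw [h]
      · rw [h, neg_smul, radialMellin_neg (eulerProd_even k hu)]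
    rw [regularizedMellin, indicator_of_mem hx', indicator_of_mem htx, h1, hν]
    rw [show -(ν + (N : ℂ) / 2) = -ν - N / 2 by ring]
    ring

theorem homogeneousPairing_regularizedMellin {k : ℕ} {w : ℂ} (hk : ‖w‖ ≤ k)
    (hw : -((2 * k : ℕ) : ℝ) < w.re) {u : 𝓢(EuclideanSpace ℝ (Fin N), ℂ)}
    (hu : ∀ x, u (-x) = u x) (v : 𝓢(EuclideanSpace ℝ (Fin N), ℂ)) :
    homogeneousPairing (regularizedMellin k w u) (-w) v =
      (eulerFactor N k (-w))⁻¹ * (eulerFactor N k (w - N))⁻¹ *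
        ∫ x, radialMellin w (eulerProd k u) x * eulerProd k (evenPart v) x := by
  have hmem := regularizedMellin_mem (ν := w - N / 2) hu hw (by ring)
  have hext := homogeneousExtension_of_mem hmem
  rw [show -(w - (N : ℂ) / 2) - N / 2 = -w by ring] at hext
  rw [(isEvenOffZero_of_mem hmem).homogeneousPairing_eq (k := k) (by rwa [norm_neg]),
    regularizedPairing, hext, mul_assoc]
  congr 1
  rw [← integral_const_mul]
  have hne : ∀ᵐ x : EuclideanSpace ℝ (Fin N), x ≠ 0 := by simp [ae_iff]
  refine integral_congr_ae ?_
  filter_upwards [hne] with x hx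
  rw [regularizedMellin, indicator_of_mem (by simpa using hx)]
  ring

/-- The Fourier transform of the homogeneous distribution given by the Mellin transform of `u` at
`w` is given by the Mellin transform of the Fourier transform of `u` at `N - w`. -/
theorem homogeneousPairing_fourier {k : ℕ} {w : ℂ} (hk : ‖w‖ ≤ k) (hk' : ‖(N : ℂ) - w‖ ≤ k)
    (h1 : -((2 * k : ℕ) : ℝ) < w.re) (h2 : w.re < N + (2 * k : ℕ))
    {u : 𝓢(EuclideanSpace ℝ (Fin N), ℂ)} (hu : ∀ x, u (-x) = u x)
    (v : 𝓢(EuclideanSpace ℝ (Fin N), ℂ)) :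
    homogeneousPairing (regularizedMellin k w u) (-w) (𝓕 v) =
      homogeneousPairing (regularizedMellin k (N - w) (𝓕 u)) (-(N - w)) v := by
  rw [homogeneousPairing_regularizedMellin hk h1 hu, ← fourier_evenPart,
    integral_radialMellin_eulerProd_fourier hu (evenPart_even v) h1 h2,
    homogeneousPairing_regularizedMellin hk' (by simp at *; linarith) (fourier_even hu),
    show (N : ℂ) - w - N = -w by ring, show -((N : ℂ) - w) = w - N by ring]
  ring

omit [NeZero N] in
/-- Every homogeneous function is a regularized Mellin transform: that of its product with a
suitable radial bump function supported away from the origin. -/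
theorem exists_regularizedMellin_eq {ν : ℂ} {f : EuclideanSpace ℝ (Fin N) → ℂ}
    (hf : f ∈ homogeneousFunctions N ν) {w : ℂ} (hw : w = ν + N / 2)
    (hw' : ∀ j : ℕ, w ≠ -(2 * j : ℂ)) :
    ∃ u : 𝓢(EuclideanSpace ℝ (Fin N), ℂ), (∀ x, u (-x) = u x) ∧
      ∀ k, regularizedMellin k w u = f := by
  have hp := isEvenOffZero_of_mem hf
  -- The bump is supported in `[1, 3]`, so that its product with `f` vanishes near the origin.
  set η : ContDiffBump (2 : ℝ) := ⟨1 / 2, 1, by norm_num, by norm_num⟩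
  have hη0 : ∀ t : ℝ, t ≤ 1 → η t = 0 := fun t ht => by
    refine η.zero_of_le_dist ?_
    rw [Real.dist_eq, abs_of_nonpos (by linarith)]
    change (1 : ℝ) ≤ _
    linarith
  have hη3 : ∀ t : ℝ, 3 ≤ t → η t = 0 := fun t ht => by
    refine η.zero_of_le_dist ?_
    rw [Real.dist_eq, abs_of_nonneg (by linarith)]
    change (1 : ℝ) ≤ _
    linarith
  set c : ℝ := ∫ t in Ioi (0 : ℝ), t⁻¹ * η t with hc
  have hc0 : c ≠ 0 := by
    have hle : ∀ t : ℝ, 0 < t → 0 ≤ t⁻¹ * η t ∧ t⁻¹ * η t ≤ η t := fun t ht => by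
      refine ⟨mul_nonneg (by positivity) η.nonneg, ?_⟩
      rcases le_total t 1 with h | h
      · simp [hη0 t h]
      · exact mul_le_of_le_one_left η.nonneg (inv_le_one_of_one_le₀ h)
    have hint : IntegrableOn (fun t : ℝ => t⁻¹ * η t) (Ioi 0) := by
      refine Integrable.mono'
        (η.continuous.integrable_of_hasCompactSupport η.hasCompactSupport).integrableOn
        (measurable_inv.mul η.continuous.measurable).aestronglyMeasurable
        ((ae_restrict_iff' measurableSet_Ioi).2 (.of_forall fun t ht => ?_))
      rw [Real.norm_of_nonneg (hle t ht).1]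
      exact (hle t ht).2
    refine (setIntegral_pos_iff_support_of_nonneg_ae ((ae_restrict_iff' measurableSet_Ioi).2
      (.of_forall fun t ht => (hle t ht).1)) hint).2 ?_ |>.ne'
    refine lt_of_lt_of_le (b := volume (Ioo (1 : ℝ) 3)) (by simp) (measure_mono fun t ht => ?_)
    have ht0 : 0 < t := one_pos.trans ht.1
    refine ⟨mul_ne_zero (inv_ne_zero ht0.ne') ?_, ht0⟩
    refine (η.pos_of_mem_ball ?_).ne'
    rw [mem_ball_iff_norm, Real.norm_eq_abs, abs_lt]
    change -(1 : ℝ) < _ ∧ _ < (1 : ℝ)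
    constructor <;> linarith [ht.1, ht.2]
  set g : EuclideanSpace ℝ (Fin N) → ℂ := fun x => ((c⁻¹ * η ‖x‖ : ℝ) : ℂ) * f x with hg
  have hg0 : ∀ x : EuclideanSpace ℝ (Fin N), ‖x‖ ≤ 1 → g x = 0 := fun x hx => by
    simp [hg, hη0 _ hx]
  have hgc : HasCompactSupport g := by
    refine HasCompactSupport.intro (isCompact_closedBall (0 : EuclideanSpace ℝ (Fin N)) 3)
      fun x hx => ?_
    rw [mem_closedBall_zero_iff, not_le] at hx
    simp [hg, hη3 _ hx.le]
  have hgs : ContDiff ℝ ∞ g := by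
    refine contDiff_iff_contDiffAt.2 fun x => ?_
    rcases eq_or_ne x 0 with rfl | hx
    · refine contDiffAt_const (c := (0 : ℂ)) |>.congr_of_eventuallyEq ?_
      filter_upwards [Metric.closedBall_mem_nhds (0 : EuclideanSpace ℝ (Fin N)) one_pos] with y hy
      exact hg0 y (by simpa using hy)
    · have h1 : ContDiffAt ℝ ∞ f x := hf.2.1.contDiffAt (isOpen_compl_singleton.mem_nhds hx)
      have h2 : ContDiffAt ℝ ∞ (fun x : EuclideanSpace ℝ (Fin N) => c⁻¹ * η ‖x‖) x :=
        contDiffAt_const.mul (η.contDiff.contDiffAt.comp x (contDiffAt_norm ℝ hx))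
      exact (Complex.ofRealCLM.contDiff.contDiffAt.comp x h2).mul h1
  set u : 𝓢(EuclideanSpace ℝ (Fin N), ℂ) := hgc.toSchwartzMap hgs
  have hu : ∀ x, u x = g x := fun x => rfl
  refine ⟨u, fun x => ?_, fun k => ?_⟩
  · rw [hu, hu]
    simp only [hg, norm_neg, hp.even]
  funext x
  rcases eq_or_ne x 0 with rfl | hx
  · simp [regularizedMellin, hf.1]
  obtain ⟨m, hm⟩ := exists_nat_gt (-w.re)
  have hv : VanishesToOrder m u := by
    refine VanishesToOrder.of_eventuallyEq_zero ?_ m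
    filter_upwards [Metric.closedBall_mem_nhds (0 : EuclideanSpace ℝ (Fin N)) one_pos] with y hy
    exact hg0 y (by simpa using hy)
  have hx' : 0 < ‖x‖ := norm_pos_iff.2 hx
  have hM : radialMellin w u x = f x := by
    have h1 : radialMellin w u x =
        ∫ t in Ioi (0 : ℝ), ((c⁻¹ * (t⁻¹ * η (t * ‖x‖)) : ℝ) : ℂ) * f x := by
      refine setIntegral_congr_fun measurableSet_Ioi fun t ht => ?_
      have ht : 0 < t := ht
      have ht' : (t : ℂ) ≠ 0 := by exact_mod_cast ht.ne'
      have h2 := hf.2.2 t ht.ne' x hx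
      rw [abs_of_pos ht, show -ν - (N : ℂ) / 2 = -w by rw [hw]; ring] at h2
      have h3 : (t : ℂ) ^ (w - 1) * (t : ℂ) ^ (-w) = ((t⁻¹ : ℝ) : ℂ) := by
        rw [← Complex.cpow_add _ _ ht', show w - 1 + -w = -1 by ring, Complex.cpow_neg_one]
        simp
      simp only [hu, hg, h2, norm_smul, Real.norm_of_nonneg ht.le, smul_eq_mul]
      push_cast at h3 ⊢
      linear_combination ((c : ℂ)⁻¹ * (η (t * ‖x‖) : ℂ) * f x) * h3
    have h4 : ∫ t in Ioi (0 : ℝ), t⁻¹ * η (t * ‖x‖) = c := by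
      have h5 := integral_comp_mul_right_Ioi (fun t => t⁻¹ * η t) 0 hx'
      rw [zero_mul, ← hc, smul_eq_mul] at h5
      have h6 : ∀ t : ℝ, t⁻¹ * η (t * ‖x‖) = ‖x‖ * ((t * ‖x‖)⁻¹ * η (t * ‖x‖)) := fun t => by
        rw [mul_inv]; field_simp
      simp only [h6]
      rw [integral_const_mul, h5, mul_inv_cancel_left₀ hx'.ne']
    rw [h1, integral_mul_const, integral_complex_ofReal, integral_const_mul, h4,
      inv_mul_cancel₀ hc0, Complex.ofReal_one, one_mul]
  have hfac : ∏ j ∈ Finset.range k, (-w - 2 * j : ℂ) = eulerFactor N k (w - N) := by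
    unfold eulerFactor
    refine Finset.prod_congr rfl fun j _ => ?_
    ring
  have hfac0 : eulerFactor N k (w - N) ≠ 0 :=
    eulerFactor_ne_zero fun j h => hw' j (by linear_combination h)
  rw [regularizedMellin, indicator_of_mem (by simpa using hx),
    radialMellin_eulerProd hv (by linarith) k hx, hfac, hM, inv_mul_cancel_left₀ hfac0]

/-- The Fourier transform maps homogeneous distributions of degree `-ν - N / 2` to those of
degree `ν - N / 2`. -/
theorem exists_fourier_homogeneousEmbedding_eq {ν ν' : ℂ} (hνν' : ν' = -ν)
    (hν : ∀ j : ℕ, ν ≠ -((N : ℂ) / 2 + 2 * j)) (f : homogeneousFunctions N ν) :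
    ∃ g : homogeneousFunctions N ν',
      𝓕 (homogeneousEmbedding N ν f) = homogeneousEmbedding N ν' g := by
  set w : ℂ := ν + N / 2 with hw
  obtain ⟨u, hu, huf⟩ := exists_regularizedMellin_eq f.2 hw fun j h =>
    hν j (by linear_combination h)
  obtain ⟨k, hk⟩ := exists_nat_gt (max ‖w‖ ‖(N : ℂ) - w‖)
  have h1 := (le_max_left _ _).trans hk.le
  have h2 := (le_max_right _ _).trans hk.le
  have h3 := (abs_le.1 (Complex.abs_re_le_norm w))
  have h4 : ‖w‖ < k := (le_max_left _ _).trans_lt hk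
  have h5 := norm_nonneg w
  have h6 : -((2 * k : ℕ) : ℝ) < w.re := by push_cast; linarith [h3.1]
  have h7 : w.re < N + (2 * k : ℕ) := by
    have : (0 : ℝ) ≤ N := Nat.cast_nonneg N
    push_cast; linarith [h3.2]
  refine ⟨⟨regularizedMellin k (N - w) (𝓕 u), regularizedMellin_mem (fourier_even hu)
    (by simp at *; linarith) (by rw [hw, hνν']; ring)⟩, ?_⟩
  ext v
  rw [TemperedDistribution.fourier_apply, homogeneousEmbedding_apply, homogeneousEmbedding_apply]
  have h8 := homogeneousPairing_fourier h1 h2 h6 h7 hu v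
  rw [huf] at h8
  convert h8 using 2
  · rw [hw]; ring
  · rw [hw, hνν']; ring

/-- The square of the Fourier transform is the reflection, which fixes even distributions. -/
theorem fourier_fourier_homogeneousEmbedding {ν : ℂ} (f : homogeneousFunctions N ν) :
    𝓕 (𝓕 (homogeneousEmbedding N ν f)) = homogeneousEmbedding N ν f := by
  ext v
  have h : 𝓕 (𝓕 v) = reflection v := by
    ext x
    have h1 : 𝓕⁻ (𝓕 v) (-x) = v (-x) := by rw [FourierTransform.fourierInv_fourier_eq]
    rw [reflection_apply, ← h1, fourierInv_coe, fourier_coe, Real.fourierInv_eq_fourier_neg,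
      neg_neg]
  rw [TemperedDistribution.fourier_apply, TemperedDistribution.fourier_apply, h,
    homogeneousEmbedding_apply, homogeneousEmbedding_apply, homogeneousPairing, homogeneousPairing,
    regularizedPairing, regularizedPairing, evenPart_reflection]

end

end

theorem proposition2p6 (N : ℕ) (hN : 0 < N) (μ : ℂ)
    (hμ : ∀ k : ℕ, μ ≠ (N : ℂ) / 2 + 2 * (k : ℂ) ∧ μ ≠ -((N : ℂ) / 2 + 2 * (k : ℂ))) :
    ∃ (ι₁ : homogeneousFunctions N (-μ) →ₗ[ℂ] 𝓢'(EuclideanSpace ℝ (Fin N), ℂ))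
      (ι₂ : homogeneousFunctions N μ →ₗ[ℂ] 𝓢'(EuclideanSpace ℝ (Fin N), ℂ)),
      IsCanonicalEmbedding N (-μ) ι₁ ∧ IsCanonicalEmbedding N μ ι₂ ∧
      Set.BijOn (fun T : 𝓢'(EuclideanSpace ℝ (Fin N), ℂ) => 𝓕 T)
        (Set.range ι₁) (Set.range ι₂) := by
  have : NeZero N := ⟨hN.ne'⟩
  refine ⟨homogeneousEmbedding N (-μ), homogeneousEmbedding N μ,
    isCanonicalEmbedding_homogeneousEmbedding fun j h => (hμ j).2 (by linear_combination h),
    isCanonicalEmbedding_homogeneousEmbedding fun j h => (hμ j).1 (by linear_combination -h),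
    ?_, ?_, ?_⟩
  · rintro _ ⟨f, rfl⟩
    obtain ⟨g, hg⟩ := exists_fourier_homogeneousEmbedding_eq (neg_neg μ).symm
      (fun j h => (hμ j).1 (by linear_combination -h)) f
    exact ⟨g, hg.symm⟩
  · intro S _ T _ h
    have := congrArg (fun T => 𝓕⁻ T) h
    simpa using this
  · rintro _ ⟨g, rfl⟩
    obtain ⟨f, hf⟩ := exists_fourier_homogeneousEmbedding_eq rfl (fun j => (hμ j).2) g
    refine ⟨_, ⟨f, rfl⟩, ?_⟩
    simp only [← hf]
    exact fourier_fourier_homogeneousEmbedding g
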